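/- **Model.** Let $G=(V,E)$ be an unweighted directed graph without parallel edges, with $n\ge 1$ vertices $V=\{0,\dots,n-1\}$ (an undirected graph is viewed as a directed graph with symmetric edge set). The degree $\deg(v)$ is the number of outgoing edges of $v$, and $\overline{\Delta}=\frac1n\sum_{v\in V}\deg(v)$ is the average degree. For $s,t\in V$ let $d(s,t)\in\mathbb N\cup\{\infty\}$ be the minimum number of edges of a directed walk from $s$ to $t$, with $d(s,t)=\infty$ if $t$ is not reachable from $s$. Algorithms are deterministic programs for the word RAM with word size $w=\Omega(\log n)$, with unit-cost instructions: constants and copies, addition and subtraction of words (modulo $2^w$), comparison of words with conditional jumps, reading and writing memory cells by indirect addressing, read-only access to the input (the number $n$, the degree of a vertex, the $i$-th entry of the adjacency list of a vertex; the lists are in arbitrary order), and emission of a triple $(a,b,d)$ or $(a,b,\infty)$ to a write-only output. Registers and memory are uninitialized: they hold arbitrary words at the start. There is no preprocessing phase. The *delay* of a computation is the largest number of steps from the start or from an emission to the next emission or to the halt. The *space* is the number of words in the shortest initial segment of the memory that contains all memory cells read or written. **Theorem.** Unweighted (unconstrained) all-pairs shortest distance (APSD) enumeration can be solved with delay in $O(\overline{\Delta})$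 and space complexity in $\Theta(n)$, where $O(\overline\Delta)$ is understood as $O(\overline{\Delta}+1)$. That is, there are one program and constants $K\in\mathbb N$ and $C,c_1,c_2\in\mathbb R$ with $c_1>0$ such that for every $n\ge 1$, every graph $G$ on $n$ vertices, every adjacency list encoding of $G$, every word size $w\ge K(\lfloor\log_2 n\rfloor+1)$ and every initial content of registers and memory, the program halts after having emitted, in some order, each triple $(s,t,d(s,t))$ with $s,t\in V$ exactly once and nothing else, its delay is at most $C(\overline{\Delta}+1)$, and it uses at least $c_1 n$ and at most $c_2 n$ words of memory. -/

import Mathlib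

open scoped BigOperators

namespace APSD

/-! Graphs on the vertex set `{0, …, n-1}`. An undirected graph is a digraph with symmetric
adjacency. -/

/-- `HasWalk G k s t`: there is a directed walk with exactly `k` edges from `s` to `t`. -/
def HasWalk {V : Type*} (G : Digraph V) : ℕ → V → V → Prop
  | 0, s, t => s = t
  | k + 1, s, t => ∃ u, HasWalk G k s u ∧ G.Adj u t

/-- The shortest distance `d(s, t)`, which is `⊤` if `t` is not reachable from `s`. -/
noncomputable def dist {V : Type*} (G : Digraph V) (s t : V) : ℕ∞ :=
  ⨅ (k : ℕ) (_ : HasWalk G k s t), (k : ℕ∞)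

/-- The degree of `v`: the number of outgoing edges. -/
noncomputable def degree {V : Type*} (G : Digraph V) (v : V) : ℕ :=
  {u | G.Adj v u}.ncard

/-- The average degree. -/
noncomputable def avgDegree {n : ℕ} (G : Digraph (Fin n)) : ℝ :=
  (∑ v, (degree G v : ℝ)) / (n : ℝ)

/-- `adj` is an adjacency list encoding of `G`: the list of `v` holds the heads of the edges that
leave `v`, each once, in any order. -/
def IsAdjLists {n : ℕ} (G : Digraph (Fin n)) (adj : Fin n → List (Fin n)) : Prop :=
  ∀ v, (adj v).Nodup ∧ ∀ u, u ∈ adj v ↔ G.Adj v u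

/-- The list of emitted triples holds `(s, t, d(s, t))` for all vertices `s` and `t`, each exactly
once, and nothing else. -/
def IsEnumeration {n : ℕ} (G : Digraph (Fin n)) (out : List (ℕ × ℕ × ℕ∞)) : Prop :=
  out.Nodup ∧ ∀ x, x ∈ out ↔ ∃ s t : Fin n, x = ((s : ℕ), (t : ℕ), dist G s t)

/-! The word RAM with read-only graph input and write-only output. -/

/-- Instructions. Operands `r a b d` are names of registers, `k` is a constant, and `l` is a
position in the program. -/
inductive Instr where
  /-- `reg r := k` -/
  | const (r k : ℕ)
  /-- `reg r := reg a` -/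
  | copy (r a : ℕ)
  /-- `reg r := reg a + reg b` -/
  | add (r a b : ℕ)
  /-- `reg r := reg a - reg b` -/
  | sub (r a b : ℕ)
  /-- `reg r := mem (reg a)` -/
  | load (r a : ℕ)
  /-- `mem (reg a) := reg r` -/
  | store (a r : ℕ)
  /-- `reg r :=` the number of vertices of the input graph -/
  | order (r : ℕ)
  /-- `reg r :=` the degree of vertex `reg a` -/
  | deg (r a : ℕ)
  /-- `reg r :=` the entry at position `reg b` (from 0) of the adjacency list of vertex `reg a` -/
  | nbr (r a b : ℕ)
  /-- continue at `l` -/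
  | jump (l : ℕ)
  /-- if `reg a < reg b`, continue at `l` -/
  | jumpLt (a b l : ℕ)
  /-- if `reg a = reg b`, continue at `l` -/
  | jumpEq (a b l : ℕ)
  /-- emit `(reg a, reg b, reg d)` -/
  | emit (a b d : ℕ)
  /-- emit `(reg a, reg b, ∞)` -/
  | emitTop (a b : ℕ)

/-- A program is a finite list of instructions. It therefore names finitely many registers. -/
abbrev Program := List Instr

/-- A configuration of the machine; `out` lists the emitted triples in the order of emission. -/
@[ext]
structure Config where
  pc : ℕ
  reg : ℕ → ℕ
  mem : ℕ → ℕ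
  out : List (ℕ × ℕ × ℕ∞)

/-- Write the value `x`, cut to `w` bits, to register `r` and go to the next instruction. -/
def Config.setReg (w : ℕ) (c : Config) (r x : ℕ) : Config :=
  { c with pc := c.pc + 1, reg := Function.update c.reg r (x % 2 ^ w) }

/-- The degree of vertex `v` as given by the input (0 if there is no such vertex). -/
def inputDeg {n : ℕ} (adj : Fin n → List (Fin n)) (v : ℕ) : ℕ :=
  if h : v < n then (adj ⟨v, h⟩).length else 0

/-- Entry `i` of the adjacency list of `v` (0 if there is no such vertex or entry). -/
def inputNbr {n : ℕ} (adj : Fin n → List (Fin n)) (v i : ℕ) : ℕ :=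
  if h : v < n then
    match (adj ⟨v, h⟩)[i]? with
    | some u => (u : ℕ)
    | none => 0
  else 0

/-- The effect of one instruction; arithmetic is modulo `2 ^ w`. -/
def exec (w : ℕ) {n : ℕ} (adj : Fin n → List (Fin n)) (c : Config) : Instr → Config
  | .const r k => c.setReg w r k
  | .copy r a => c.setReg w r (c.reg a)
  | .add r a b => c.setReg w r (c.reg a + c.reg b)
  | .sub r a b => c.setReg w r (c.reg a + 2 ^ w - c.reg b)
  | .load r a => c.setReg w r (c.mem (c.reg a))
  | .store a r =>
      { c with pc := c.pc + 1, mem := Function.update c.mem (c.reg a) (c.reg r) }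
  | .order r => c.setReg w r n
  | .deg r a => c.setReg w r (inputDeg adj (c.reg a))
  | .nbr r a b => c.setReg w r (inputNbr adj (c.reg a) (c.reg b))
  | .jump l => { c with pc := l }
  | .jumpLt a b l => { c with pc := if c.reg a < c.reg b then l else c.pc + 1 }
  | .jumpEq a b l => { c with pc := if c.reg a = c.reg b then l else c.pc + 1 }
  | .emit a b d =>
      { c with pc := c.pc + 1, out := c.out ++ [(c.reg a, c.reg b, (c.reg d : ℕ∞))] }
  | .emitTop a b => { c with pc := c.pc + 1, out := c.out ++ [(c.reg a, c.reg b, ⊤)] }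

/-- The machine has halted when the program counter is outside the program. -/
def Halted (P : Program) (c : Config) : Prop := P[c.pc]? = none

/-- One step of the machine; a halted configuration does not change. -/
def step (P : Program) (w : ℕ) {n : ℕ} (adj : Fin n → List (Fin n)) (c : Config) : Config :=
  match P[c.pc]? with
  | none => c
  | some i => exec w adj c i

/-- The configuration after `t` steps. Every instruction takes one step. -/
def run (P : Program) (w : ℕ) {n : ℕ} (adj : Fin n → List (Fin n)) (c₀ : Config) (t : ℕ) :
    Config :=
  (step P w adj)^[t] c₀

/-- The configurations in which a computation with word size `w` may start: at the first
instruction, with no output so far, and with arbitrary (uninitialized) words in the registers and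
in the memory. -/
def IsInitial (w : ℕ) (c : Config) : Prop :=
  c.pc = 0 ∧ c.out = [] ∧ (∀ r, c.reg r < 2 ^ w) ∧ ∀ x, c.mem x < 2 ^ w

/-- The computation from `c₀` has delay at most `D`: from any time at which the machine is not yet
halted, in particular from the start and from any emission, at most `D` steps pass until the next
output is emitted or the machine halts. -/
def HasDelay (P : Program) (w : ℕ) {n : ℕ} (adj : Fin n → List (Fin n)) (c₀ : Config) (D : ℕ) :
    Prop :=
  ∀ t, ¬ Halted P (run P w adj c₀ t) →
    (run P w adj c₀ t).out.length < (run P w adj c₀ (t + D)).out.length ∨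
      Halted P (run P w adj c₀ (t + D))

/-- The next step from `c` reads or writes memory cell `x`. -/
def Accesses (P : Program) (c : Config) (x : ℕ) : Prop :=
  (∃ r a, P[c.pc]? = some (.load r a) ∧ c.reg a = x) ∨
    ∃ a r, P[c.pc]? = some (.store a r) ∧ c.reg a = x

/-- The space used by the computation from `c₀`, in words: the size of the shortest initial segment
of the memory that contains all cells the computation reads or writes. -/
noncomputable def space (P : Program) (w : ℕ) {n : ℕ} (adj : Fin n → List (Fin n))
    (c₀ : Config) : ℕ∞ :=
  ⨆ (x : ℕ) (_ : ∃ t, Accesses P (run P w adj c₀ t) x), ((x + 1 : ℕ) : ℕ∞)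

end APSD

/-!
Breadth-first search from all sources, one after the other, takes `O(n + m)` steps per source, where
`m` is the number of edges, and yields `n` triples per source; so the delay is right on average. To
make it right in the worst case, the output of one source is delayed: while the search from `s`
fills one distance table, the distances from `s - 1` are emitted from a second one, a triple after
every `quota` search steps, where `quota` is about three times the average degree. The two tables
and the queue take `3 * n` words.

While the first search runs no distances are available yet, and there is no time for preprocessing.
At this point the triples `(v, v, 0)`, which need no computation, are emitted (and they are left out
later on). Half of them pay for counting the edges, two vertices for each triple, and the other half
for the search from `0`. Between these, `m / n` is computed by repeated subtraction, which takes
`O(m / n)` steps and thus fits into the delay. As at least a third of the targets remain for each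
search, every search is complete when its table is needed (`search_lt_mul_quota`,
`SearchInv.isCode`).

The program is a single loop with a loop-free body. Loop-free code is handled by a weakest
precondition calculus (`Cmd.wp`), whose side conditions exclude overflow and bound the addresses of
memory accesses, and which is sound for the compiled code (`Cmd.leads_of_wp`). From a loop invariant
and a measure that decreases in each iteration without output, `loopProgram_spec` derives the delay
and, because the output is bounded, also termination. The correctness of the search itself rests on
the invariant `Search`: depths do not decrease along the queue, and those beyond the head differ by
at most one from the depth of the vertex being scanned, so that in the end no edge can shorten a
distance (`Search.finish`).
-/

namespace APSD

/-! ### Loop-free commands and their weakest preconditions -/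

/-- The part of a configuration that does not depend on the position in the program. -/
structure State where
  reg : ℕ → ℕ
  mem : ℕ → ℕ
  out : List (ℕ × ℕ × ℕ∞)

/-- The configuration with state `σ` and program counter `p`. -/
def State.toConfig (σ : State) (p : ℕ) : Config := ⟨p, σ.reg, σ.mem, σ.out⟩

/-- The state after the assignment `reg r := x`. -/
def State.set (σ : State) (r x : ℕ) : State := { σ with reg := Function.update σ.reg r x }

/-- Loop-free structured code. The instruction of an `atom` is meant not to be a jump. -/
inductive Cmd where
  | skip
  | atom (i : Instr)
  | seq (c d : Cmd)
  /-- if `reg a < reg b` then `c` else `d` -/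
  | ifLt (a b : ℕ) (c d : Cmd)
  /-- if `reg a = reg b` then `c` else `d` -/
  | ifEq (a b : ℕ) (c d : Cmd)

/-- The number of instructions that a command is compiled to. -/
def Cmd.size : Cmd → ℕ
  | skip => 0
  | atom _ => 1
  | seq c d => c.size + d.size
  | ifLt _ _ c d => c.size + d.size + 2
  | ifEq _ _ c d => c.size + d.size + 2

/-- The instructions of a command whose code starts at position `p`. The `else` branch comes first,
so that all jumps go forward. -/
def Cmd.compile : Cmd → ℕ → List Instr
  | skip, _ => []
  | atom i, _ => [i]
  | seq c d, p => c.compile p ++ d.compile (p + c.size)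
  | ifLt a b c d, p =>
      .jumpLt a b (p + d.size + 2) :: (d.compile (p + 1) ++
        .jump (p + d.size + 2 + c.size) :: c.compile (p + d.size + 2))
  | ifEq a b c d, p =>
      .jumpEq a b (p + d.size + 2) :: (d.compile (p + 1) ++
        .jump (p + d.size + 2 + c.size) :: c.compile (p + d.size + 2))

/-- The weakest precondition of a single instruction other than a jump: besides the postcondition
`Q` it demands that the instruction causes no arithmetic overflow for words below `W` and accesses
only memory cells below `B`. -/
def wpInstr (W B : ℕ) {n : ℕ} (adj : Fin n → List (Fin n)) (Q : State → Prop) (σ : State) :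
    Instr → Prop
  | .const r k => k < W ∧ Q (σ.set r k)
  | .copy r a => σ.reg a < W ∧ Q (σ.set r (σ.reg a))
  | .add r a b => σ.reg a + σ.reg b < W ∧ Q (σ.set r (σ.reg a + σ.reg b))
  | .sub r a b => σ.reg a < W ∧ σ.reg b ≤ σ.reg a ∧ Q (σ.set r (σ.reg a - σ.reg b))
  | .load r a => σ.reg a < B ∧ σ.mem (σ.reg a) < W ∧ Q (σ.set r (σ.mem (σ.reg a)))
  | .store a r => σ.reg a < B ∧ Q { σ with mem := Function.update σ.mem (σ.reg a) (σ.reg r) }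
  | .order r => n < W ∧ Q (σ.set r n)
  | .deg r a => inputDeg adj (σ.reg a) < W ∧ Q (σ.set r (inputDeg adj (σ.reg a)))
  | .nbr r a b => inputNbr adj (σ.reg a) (σ.reg b) < W ∧
      Q (σ.set r (inputNbr adj (σ.reg a) (σ.reg b)))
  | .emit a b d => Q { σ with out := σ.out ++ [(σ.reg a, σ.reg b, (σ.reg d : ℕ∞))] }
  | .emitTop a b => Q { σ with out := σ.out ++ [(σ.reg a, σ.reg b, ⊤)] }
  | .jump _ => False
  | .jumpLt _ _ _ => False
  | .jumpEq _ _ _ => False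

/-- The weakest precondition of a command, with the side conditions of `wpInstr`. -/
def Cmd.wp (W B : ℕ) {n : ℕ} (adj : Fin n → List (Fin n)) :
    Cmd → (State → Prop) → State → Prop
  | skip, Q, σ => Q σ
  | atom i, Q, σ => wpInstr W B adj Q σ i
  | seq c d, Q, σ => c.wp W B adj (d.wp W B adj Q) σ
  | ifLt a b c d, Q, σ =>
      (σ.reg a < σ.reg b → c.wp W B adj Q σ) ∧ (¬ σ.reg a < σ.reg b → d.wp W B adj Q σ)
  | ifEq a b c d, Q, σ =>
      (σ.reg a = σ.reg b → c.wp W B adj Q σ) ∧ (¬ σ.reg a = σ.reg b → d.wp W B adj Q σ)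

section
variable {W B w n : ℕ} {adj : Fin n → List (Fin n)} {P : Program}

theorem wpInstr_mono {Q R : State → Prop} (h : ∀ σ, Q σ → R σ) {σ : State} {i : Instr}
    (hi : wpInstr W B adj Q σ i) : wpInstr W B adj R σ i := by
  cases i <;> simp only [wpInstr] at hi ⊢ <;> first | exact h _ hi | tauto

theorem Cmd.wp_mono {c : Cmd} : ∀ {Q R : State → Prop}, (∀ σ, Q σ → R σ) →
    ∀ {σ : State}, c.wp W B adj Q σ → c.wp W B adj R σ := by
  induction c with
  | skip => intro Q R h σ hq; exact h _ hq
  | atom i => intro Q R h σ hq; exact wpInstr_mono h hq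
  | seq c d hc hd => intro Q R h σ hq; exact hc (fun σ' => hd h) hq
  | ifLt a b c d hc hd =>
    intro Q R h σ hq; exact ⟨fun hl => hc h (hq.1 hl), fun hl => hd h (hq.2 hl)⟩
  | ifEq a b c d hc hd =>
    intro Q R h σ hq; exact ⟨fun hl => hc h (hq.1 hl), fun hl => hd h (hq.2 hl)⟩

theorem Cmd.wp_seq {c d : Cmd} {Q R : State → Prop} {σ : State}
    (hc : c.wp W B adj R σ) (hd : ∀ σ', R σ' → d.wp W B adj Q σ') :
    (Cmd.seq c d).wp W B adj Q σ :=
  Cmd.wp_mono hd hc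

theorem Cmd.length_compile (c : Cmd) : ∀ p, (c.compile p).length = c.size := by
  induction c with
  | skip => intro p; rfl
  | atom i => intro p; rfl
  | seq c d hc hd => intro p; simp [compile, size, hc, hd]
  | ifLt a b c d hc hd => intro p; simp [compile, size, hc, hd]; omega
  | ifEq a b c d hc hd => intro p; simp [compile, size, hc, hd]; omega

theorem run_zero (c : Config) : run P w adj c 0 = c := rfl

theorem run_add (c : Config) (s t : ℕ) :
    run P w adj c (s + t) = run P w adj (run P w adj c s) t := by
  rw [add_comm]; exact Function.iterate_add_apply _ _ _ _

theorem run_one (c : Config) : run P w adj c 1 = step P w adj c := rfl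

/-- The code `l` stands at position `p` of the program `P`. -/
def CodeAt (P : Program) (p : ℕ) (l : List Instr) : Prop :=
  ∃ l₁ l₂, P = l₁ ++ l ++ l₂ ∧ l₁.length = p

theorem CodeAt.left {p : ℕ} {l l' : List Instr} (h : CodeAt P p (l ++ l')) : CodeAt P p l := by
  obtain ⟨a, b, rfl, h⟩ := h
  exact ⟨a, l' ++ b, by simp, h⟩

theorem CodeAt.right {p : ℕ} {l l' : List Instr} (h : CodeAt P p (l ++ l')) :
    CodeAt P (p + l.length) l' := by
  obtain ⟨a, b, rfl, h⟩ := h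
  exact ⟨a ++ l, b, by simp, by simp [h]⟩

theorem CodeAt.tail {p : ℕ} {i : Instr} {l : List Instr} (h : CodeAt P p (i :: l)) :
    CodeAt P (p + 1) l := by
  have h : CodeAt P p ([i] ++ l) := h
  simpa using h.right

theorem CodeAt.head {p : ℕ} {i : Instr} {l : List Instr} (h : CodeAt P p (i :: l)) :
    P[p]? = some i := by
  obtain ⟨a, b, rfl, rfl⟩ := h
  simp

/-- Within `L` steps the computation from `c` comes to a configuration that satisfies `Q`, and on
the way it accesses only memory cells below `B`. -/
def Leads (P : Program) (w : ℕ) {n : ℕ} (adj : Fin n → List (Fin n)) (B L : ℕ)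
    (Q : Config → Prop) (c : Config) : Prop :=
  ∃ k ≤ L, Q (run P w adj c k) ∧ ∀ i < k, ∀ x, Accesses P (run P w adj c i) x → x < B

theorem Leads.refl {Q : Config → Prop} {c : Config} (h : Q c) : Leads P w adj B 0 Q c :=
  ⟨0, le_rfl, h, by simp⟩

theorem Leads.trans {Q R : Config → Prop} {c : Config} {L L' : ℕ} (h : Leads P w adj B L Q c)
    (h' : ∀ c, Q c → Leads P w adj B L' R c) : Leads P w adj B (L + L') R c := by
  obtain ⟨k, hk, hq, ha⟩ := h
  obtain ⟨k', hk', hq', ha'⟩ := h' _ hq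
  refine ⟨k + k', by omega, by rwa [run_add], fun i hi x hx => ?_⟩
  by_cases hik : i < k
  · exact ha i hik x hx
  · refine ha' (i - k) (by omega) x ?_
    rwa [← run_add, Nat.add_sub_cancel' (by omega)]

theorem Leads.mono {Q R : Config → Prop} {c : Config} {L L' : ℕ} (h : Leads P w adj B L Q c)
    (hL : L ≤ L') (hQ : ∀ c, Q c → R c) : Leads P w adj B L' R c := by
  obtain ⟨k, hk, hq, ha⟩ := h
  exact ⟨k, hk.trans hL, hQ _ hq, ha⟩

theorem Leads.step {Q : Config → Prop} {c : Config} (h : Q (step P w adj c))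
    (ha : ∀ x, Accesses P c x → x < B) : Leads P w adj B 1 Q c :=
  ⟨1, le_rfl, h, fun i hi x hx => ha x (by obtain rfl : i = 0 := by omega
                                           exact hx)⟩

theorem leads_of_wpInstr {Q : State → Prop} {σ : State} {i : Instr} {p : ℕ}
    (hP : P[p]? = some i) (h : wpInstr (2 ^ w) B adj Q σ i) :
    Leads P w adj B 1 (fun c => ∃ σ', Q σ' ∧ c = σ'.toConfig (p + 1)) (σ.toConfig p) := by
  have hpc : P[(σ.toConfig p).pc]? = some i := hP
  apply Leads.step
  · simp only [APSD.step, hpc]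
    cases i <;> simp only [wpInstr] at h <;>
      simp only [exec, Config.setReg, State.toConfig] <;>
      first
      | exact h.elim
      | exact ⟨_, h, rfl⟩
      | exact ⟨_, h.2, rfl⟩
      | (refine ⟨_, h.2, ?_⟩; rw [Nat.mod_eq_of_lt h.1]; rfl)
      | (refine ⟨_, h.2.2, ?_⟩; rw [Nat.mod_eq_of_lt h.2.1]; rfl)
      | (refine ⟨_, h.2.2, ?_⟩
         rw [Nat.sub_add_comm h.2.1, Nat.add_mod_right, Nat.mod_eq_of_lt (by omega)]; rfl)
  · rintro x (⟨r, a, h1, rfl⟩ | ⟨a, r, h1, rfl⟩)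
    · rw [hpc] at h1; cases h1; exact h.1
    · rw [hpc] at h1; cases h1; exact h.1

/-- Compiled code does what the weakest precondition promises. As its jumps all go forward, it
takes no more steps than it has instructions. -/
theorem Cmd.leads_of_wp (c : Cmd) : ∀ {Q : State → Prop} {σ : State} {p : ℕ},
    CodeAt P p (c.compile p) → c.wp (2 ^ w) B adj Q σ →
    Leads P w adj B c.size (fun d => ∃ σ', Q σ' ∧ d = σ'.toConfig (p + c.size))
      (σ.toConfig p) := by
  have hjump : ∀ {σ : State} {p l : ℕ}, P[p]? = some (.jump l) →
      Leads P w adj B 1 (fun d => d = σ.toConfig l) (σ.toConfig p) := by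
    intro σ p l hP
    have hpc : P[(σ.toConfig p).pc]? = some (.jump l) := hP
    apply Leads.step
    · simp only [APSD.step, hpc, exec]; rfl
    · rintro x (⟨r, a, h1, rfl⟩ | ⟨a, r, h1, rfl⟩) <;> rw [hpc] at h1 <;> cases h1
  have hlt : ∀ {σ : State} {p a b l : ℕ}, P[p]? = some (.jumpLt a b l) →
      Leads P w adj B 1 (fun d => d = σ.toConfig (if σ.reg a < σ.reg b then l else p + 1))
        (σ.toConfig p) := by
    intro σ p a b l hP
    have hpc : P[(σ.toConfig p).pc]? = some (.jumpLt a b l) := hP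
    apply Leads.step
    · simp only [APSD.step, hpc, exec]; rfl
    · rintro x (⟨r, a, h1, rfl⟩ | ⟨a, r, h1, rfl⟩) <;> rw [hpc] at h1 <;> cases h1
  have heq : ∀ {σ : State} {p a b l : ℕ}, P[p]? = some (.jumpEq a b l) →
      Leads P w adj B 1 (fun d => d = σ.toConfig (if σ.reg a = σ.reg b then l else p + 1))
        (σ.toConfig p) := by
    intro σ p a b l hP
    have hpc : P[(σ.toConfig p).pc]? = some (.jumpEq a b l) := hP
    apply Leads.step
    · simp only [APSD.step, hpc, exec]; rfl
    · rintro x (⟨r, a, h1, rfl⟩ | ⟨a, r, h1, rfl⟩) <;> rw [hpc] at h1 <;> cases h1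
  -- the part common to both conditionals, where `t` is the condition
  have hbranch : ∀ {c d : Cmd} {Q : State → Prop} {σ : State} {p : ℕ} {i : Instr} {t : Prop}
      [Decidable t],
      Leads P w adj B 1 (fun e => e = σ.toConfig (if t then p + d.size + 2 else p + 1))
        (σ.toConfig p) →
      CodeAt P p (i :: (d.compile (p + 1) ++
        .jump (p + d.size + 2 + c.size) :: c.compile (p + d.size + 2))) →
      (CodeAt P (p + d.size + 2) (c.compile (p + d.size + 2)) → t →
        Leads P w adj B c.size
          (fun e => ∃ σ', Q σ' ∧ e = σ'.toConfig (p + d.size + 2 + c.size))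
          (σ.toConfig (p + d.size + 2))) →
      (CodeAt P (p + 1) (d.compile (p + 1)) → ¬ t →
        Leads P w adj B d.size (fun e => ∃ σ', Q σ' ∧ e = σ'.toConfig (p + 1 + d.size))
          (σ.toConfig (p + 1))) →
      Leads P w adj B (c.size + d.size + 2)
        (fun e => ∃ σ', Q σ' ∧ e = σ'.toConfig (p + (c.size + d.size + 2))) (σ.toConfig p) := by
    intro c d Q σ p i t _ htest hcode hc hd
    have hcode1 := hcode.tail
    have hcode2 := hcode1.right
    rw [Cmd.length_compile] at hcode2
    have hcode3 := hcode2.tail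
    rw [show p + 1 + d.size + 1 = p + d.size + 2 by omega] at hcode3
    by_cases ht : t
    · simp only [ht, if_true] at htest
      refine (htest.trans (L' := c.size) (R := fun e => ∃ σ', Q σ' ∧
        e = σ'.toConfig (p + d.size + 2 + c.size)) ?_).mono (by omega) ?_
      · rintro _ rfl; exact hc hcode3 ht
      · rintro _ ⟨σ', h1, rfl⟩; exact ⟨σ', h1, by congr 1; omega⟩
    · simp only [ht, if_false] at htest
      refine ((htest.trans (L' := d.size) (R := fun e => ∃ σ', Q σ' ∧
        e = σ'.toConfig (p + 1 + d.size)) ?_).trans (L' := 1) (R := fun e => ∃ σ', Q σ' ∧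
        e = σ'.toConfig (p + (c.size + d.size + 2))) ?_).mono (by omega) fun _ h => h
      · rintro _ rfl; exact hd hcode1.left ht
      · rintro _ ⟨σ', h1, rfl⟩
        refine (hjump hcode2.head).mono le_rfl ?_
        rintro _ rfl; exact ⟨σ', h1, by congr 1; omega⟩
  induction c with
  | skip => intro Q σ p _ h; exact Leads.refl ⟨σ, h, rfl⟩
  | atom i => intro Q σ p hc h; exact leads_of_wpInstr hc.head h
  | seq c d ihc ihd =>
    intro Q σ p hc h
    refine (ihc hc.left h).trans ?_
    rintro _ ⟨σ', h', rfl⟩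
    have := hc.right
    rw [Cmd.length_compile] at this
    refine (ihd this h').mono le_rfl ?_
    rintro _ ⟨σ'', h'', rfl⟩
    exact ⟨σ'', h'', by congr 1; simp only [size]; omega⟩
  | ifLt a b c d ihc ihd =>
    intro Q σ p hc h
    exact hbranch (hlt hc.head) hc (fun h1 h2 => ihc h1 (h.1 h2)) (fun h1 h2 => ihd h1 (h.2 h2))
  | ifEq a b c d ihc ihd =>
    intro Q σ p hc h
    exact hbranch (heq hc.head) hc (fun h1 h2 => ihc h1 (h.1 h2)) (fun h1 h2 => ihd h1 (h.2 h2))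

/-! ### Programs with a single loop -/

/-- The program `pre; do body while (reg a < reg b)`. -/
def loopProgram (pre body : Cmd) (a b : ℕ) : Program :=
  pre.compile 0 ++ (body.compile pre.size ++ [.jumpLt a b pre.size])

theorem step_eq_self_of_halted {c : Config} (h : Halted P c) : step P w adj c = c := by
  simp only [Halted] at h; simp [APSD.step, h]

theorem run_eq_self_of_halted {c : Config} (h : Halted P c) (t : ℕ) : run P w adj c t = c :=
  Function.iterate_fixed (step_eq_self_of_halted h) t

theorem length_out_step (c : Config) : c.out.length ≤ (step P w adj c).out.length := by
  unfold APSD.step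
  split
  · rfl
  · rename_i i _
    cases i <;> simp [exec, Config.setReg]

theorem length_out_run (c : Config) (t : ℕ) : c.out.length ≤ (run P w adj c t).out.length := by
  induction t with
  | zero => exact le_rfl
  | succ t ih => rw [run_add]; exact ih.trans (length_out_step _)

/-- From `c` some output or the halt comes within `D` steps. -/
def Progress (P : Program) (w : ℕ) {n : ℕ} (adj : Fin n → List (Fin n)) (c : Config) (D : ℕ) :
    Prop :=
  c.out.length < (run P w adj c D).out.length ∨ Halted P (run P w adj c D)

theorem Progress.of_run {c : Config} {k D D' : ℕ} (h : Progress P w adj (run P w adj c k) D)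
    (hD : k + D ≤ D') : Progress P w adj c D' := by
  obtain ⟨r, rfl⟩ := Nat.exists_eq_add_of_le hD
  unfold Progress at *
  rw [run_add, run_add]
  rcases h with h | h
  · left
    exact ((length_out_run c k).trans_lt h).trans_le (length_out_run _ r)
  · right
    rwa [run_eq_self_of_halted h]

theorem Progress.of_length_lt {c : Config} {k D : ℕ}
    (h : c.out.length < (run P w adj c k).out.length) (hD : k ≤ D) : Progress P w adj c D := by
  obtain ⟨r, rfl⟩ := Nat.exists_eq_add_of_le hD
  left; rw [run_add]; exact h.trans_le (length_out_run _ r)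

/-- Correctness, delay and memory accesses of a program with a single loop, from a loop invariant
`Inv`. The measure `ρ` decreases in each iteration without output; this bounds the delay, and, as
the length of the output is bounded, it also yields termination. -/
theorem loopProgram_spec {pre body : Cmd} {a b M N : ℕ} {Inv Post : State → Prop} {ρ : State → ℕ}
    {σ₀ : State}
    (hpre : pre.wp (2 ^ w) B adj Inv σ₀)
    (hbody : ∀ σ, Inv σ → body.wp (2 ^ w) B adj (fun σ' =>
      (σ'.reg a < σ'.reg b → Inv σ' ∧ (σ.out.length < σ'.out.length ∨ ρ σ' < ρ σ)) ∧
      (¬ σ'.reg a < σ'.reg b → Post σ')) σ)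
    (hM : ∀ σ, Inv σ → ρ σ ≤ M) (hN : ∀ σ, Inv σ → σ.out.length ≤ N) :
    (∃ T σ, Halted (loopProgram pre body a b)
        (run (loopProgram pre body a b) w adj (σ₀.toConfig 0) T) ∧ Post σ ∧
        (run (loopProgram pre body a b) w adj (σ₀.toConfig 0) T).out = σ.out) ∧
      HasDelay (loopProgram pre body a b) w adj (σ₀.toConfig 0)
        (pre.size + (M + 2) * (body.size + 1)) ∧
      ∀ t x, Accesses (loopProgram pre body a b)
        (run (loopProgram pre body a b) w adj (σ₀.toConfig 0) t) x → x < B := by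
  set P := loopProgram pre body a b with hP
  set L := body.size + 1 with hL
  have hcode0 : CodeAt P 0 (pre.compile 0 ++ (body.compile pre.size ++ [.jumpLt a b pre.size])) :=
    ⟨[], [], by simp [hP, loopProgram], rfl⟩
  have hcode1 := hcode0.right
  rw [Cmd.length_compile, zero_add] at hcode1
  have hcode2 := hcode1.right
  rw [Cmd.length_compile] at hcode2
  have hlen : P[pre.size + body.size + 1]? = none := by
    rw [List.getElem?_eq_none_iff, hP, loopProgram]
    simp [Cmd.length_compile]; omega
  -- the configurations at the head of the loop, and the final ones
  let Cut : Config → Prop := fun c => ∃ σ, Inv σ ∧ c = σ.toConfig pre.size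
  let Final : Config → Prop := fun c => Halted P c ∧ ∃ σ, Post σ ∧ c.out = σ.out
  have hiter₀ : ∀ σ, Inv σ → Leads P w adj B L (fun c => Final c ∨ ∃ σ', Inv σ' ∧
      (σ.out.length < σ'.out.length ∨ ρ σ' < ρ σ) ∧ c = σ'.toConfig pre.size)
      (σ.toConfig pre.size) := by
    intro σ hσ
    refine (body.leads_of_wp hcode1.left (hbody σ hσ)).trans ?_
    rintro _ ⟨σ', ⟨h1, h2⟩, rfl⟩
    have hpc : P[(σ'.toConfig (pre.size + body.size)).pc]? = some (.jumpLt a b pre.size) :=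
      hcode2.head
    apply Leads.step
    · simp only [APSD.step, hpc, exec]
      by_cases h : σ'.reg a < σ'.reg b
      · right
        exact ⟨σ', (h1 h).1, (h1 h).2, by simp [State.toConfig, h]⟩
      · left
        refine ⟨?_, σ', h2 h, rfl⟩
        simp [Halted, State.toConfig, h, hlen]
    · rintro x (⟨r, a, h1, rfl⟩ | ⟨a, r, h1, rfl⟩) <;> rw [hpc] at h1 <;> cases h1
  have hnh : ∀ σ : State, ¬ Halted P (σ.toConfig pre.size) := by
    intro σ h
    have h1 : P.length ≤ pre.size := List.getElem?_eq_none_iff.1 h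
    simp [hP, loopProgram, Cmd.length_compile] at h1
  have hiter : ∀ σ, Inv σ → ∃ k, 0 < k ∧ k ≤ L ∧
      (Final (run P w adj (σ.toConfig pre.size) k) ∨ ∃ σ', Inv σ' ∧
        (σ.out.length < σ'.out.length ∨ ρ σ' < ρ σ) ∧
        run P w adj (σ.toConfig pre.size) k = σ'.toConfig pre.size) ∧
      ∀ i < k, ∀ x, Accesses P (run P w adj (σ.toConfig pre.size) i) x → x < B := by
    intro σ hσ
    obtain ⟨k, hk, hq, ha⟩ := hiter₀ σ hσ
    refine ⟨k, Nat.pos_of_ne_zero ?_, hk, hq, ha⟩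
    rintro rfl
    rcases hq with hq | ⟨σ', _, hpr, hc⟩
    · exact hnh σ hq.1
    · have h1 : σ.reg = σ'.reg := congrArg Config.reg hc
      have h2 : σ.mem = σ'.mem := congrArg Config.mem hc
      have h3 : σ.out = σ'.out := congrArg Config.out hc
      have : σ = σ' := by cases σ; cases σ'; simp_all
      subst this
      omega
  have hstart : Leads P w adj B pre.size Cut (σ₀.toConfig 0) := by
    refine (pre.leads_of_wp hcode0.left hpre).mono le_rfl ?_
    rintro _ ⟨σ', h, rfl⟩
    exact ⟨σ', h, by rw [zero_add]⟩
  -- every configuration of the computation leads to the head of the loop or to the end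
  set L' := pre.size + L with hL'
  have hreach : ∀ t, Leads P w adj B L' (fun c => Final c ∨ Cut c)
      (run P w adj (σ₀.toConfig 0) t) := by
    intro t
    induction t with
    | zero => exact hstart.mono (by omega) fun c => Or.inr
    | succ t ih =>
      rw [run_add, run_one]
      generalize run P w adj (σ₀.toConfig 0) t = c at *
      have hpos : ∀ k ≤ L', 0 < k → (Final (run P w adj c k) ∨ Cut (run P w adj c k)) →
          (∀ i < k, ∀ x, Accesses P (run P w adj c i) x → x < B) →
          Leads P w adj B L' (fun c => Final c ∨ Cut c) (step P w adj c) := by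
        intro k hk h0 hq ha
        obtain ⟨k, rfl⟩ := Nat.exists_eq_add_of_lt h0
        refine ⟨k, by omega, ?_, fun i hi x hx => ha (i + 1) (by omega) x ?_⟩
        · rw [← run_one, ← run_add]; rwa [zero_add, add_comm] at hq
        · rw [← run_one, ← run_add] at hx; rwa [add_comm]
      obtain ⟨k, hk, hq, ha⟩ := ih
      rcases Nat.eq_zero_or_pos k with rfl | h0
      · rcases hq with hq | ⟨σ, hσ, hc⟩
        · rw [run_zero] at hq
          rw [step_eq_self_of_halted hq.1]
          exact ⟨0, Nat.zero_le _, Or.inl hq, by simp⟩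
        · rw [run_zero] at hc
          obtain ⟨k, h0, hk, hq, ha⟩ := hiter σ hσ
          rw [← hc] at hq ha
          refine hpos k (by omega) h0 (hq.imp id ?_) ha
          rintro ⟨σ', hσ', _, hc'⟩
          exact ⟨σ', hσ', hc'⟩
      · exact hpos k hk h0 hq ha
  have hprog : ∀ r σ, Inv σ → ρ σ ≤ r → Progress P w adj (σ.toConfig pre.size) ((r + 1) * L) := by
    intro r
    induction r with
    | zero =>
      intro σ hσ hr
      obtain ⟨k, _, hk, hq, _⟩ := hiter σ hσ
      rcases hq with hq | ⟨σ', hσ', hpr | hpr, hc'⟩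
      · exact Progress.of_run (k := k) (D := 0) (Or.inr hq.1) (by omega)
      · exact Progress.of_length_lt (k := k) (by rw [hc']; exact hpr) (by omega)
      · omega
    | succ r ih =>
      intro σ hσ hr
      obtain ⟨k, _, hk, hq, _⟩ := hiter σ hσ
      have hle : k ≤ (r + 1 + 1) * L := hk.trans (Nat.le_mul_of_pos_left _ (by omega))
      rcases hq with hq | ⟨σ', hσ', hpr | hpr, hc'⟩
      · exact Progress.of_run (k := k) (D := 0) (Or.inr hq.1) hle
      · exact Progress.of_length_lt (k := k) (by rw [hc']; exact hpr) hle
      · refine Progress.of_run (k := k) (D := (r + 1) * L) ?_ (by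
          rw [add_mul (r + 1)]; omega)
        rw [hc']
        exact ih σ' hσ' (by omega)
  have hdelay : HasDelay P w adj (σ₀.toConfig 0) (pre.size + (M + 2) * L) := by
    intro t _
    rw [run_add]
    obtain ⟨k, hk, hq, _⟩ := hreach t
    have hM2 : (M + 2) * L = (M + 1) * L + L := by ring
    rcases hq with hq | ⟨σ, hσ, hc⟩
    · exact Progress.of_run (k := k) (D := 0) (Or.inr hq.1) (by rw [hM2]; omega)
    · refine Progress.of_run (k := k) (D := (M + 1) * L) ?_ (by rw [hM2]; omega)
      rw [hc]
      exact hprog M σ hσ (hM σ hσ)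
  refine ⟨?_, hdelay, ?_⟩
  · -- if the machine never halted, the output would become arbitrarily long
    by_contra hno
    have hcut : ∀ t, ∃ k, Cut (run P w adj (σ₀.toConfig 0) (t + k)) := by
      intro t
      obtain ⟨k, _, hq, _⟩ := hreach t
      rw [← run_add] at hq
      rcases hq with ⟨h1, σ, h2, h3⟩ | hq
      · exact (hno ⟨t + k, σ, h1, h2, h3⟩).elim
      · exact ⟨k, hq⟩
    have hbig : ∀ r, ∃ t, r ≤ (run P w adj (σ₀.toConfig 0) t).out.length := by
      intro r
      induction r with
      | zero => exact ⟨0, Nat.zero_le _⟩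
      | succ r ih =>
        obtain ⟨t, ht⟩ := ih
        have hne : ∀ t, ¬ Halted P (run P w adj (σ₀.toConfig 0) t) := by
          intro t hh
          obtain ⟨k, _, hq, _⟩ := hreach t
          rw [run_eq_self_of_halted hh] at hq
          rcases hq with ⟨h1, σ, h2, h3⟩ | ⟨σ, _, hc⟩
          · exact hno ⟨t, σ, h1, h2, h3⟩
          · exact hnh σ (hc ▸ hh)
        rcases hdelay t (hne t) with h | h
        · exact ⟨_, Nat.succ_le_of_lt (ht.trans_lt h)⟩
        · exact (hne _ h).elim
    obtain ⟨t, ht⟩ := hbig (N + 1)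
    obtain ⟨k, σ, hσ, hc⟩ := hcut t
    have h1 := length_out_run (P := P) (w := w) (adj := adj) (run P w adj (σ₀.toConfig 0) t) k
    rw [← run_add, hc] at h1
    have h2 := hN σ hσ
    have h3 : (σ.toConfig pre.size).out = σ.out := rfl
    rw [h3] at h1
    omega
  · intro t x hx
    obtain ⟨k, hk, hq, ha⟩ := hreach t
    rcases Nat.eq_zero_or_pos k with rfl | h0
    · have hnone : ∀ c, Halted P c → ¬ Accesses P c x := by
        rintro c hh (⟨r, a, h1, _⟩ | ⟨a, r, h1, _⟩) <;> rw [Halted, h1] at hh <;> cases hh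
      rw [run_zero] at hq
      rcases hq with hq | ⟨σ, hσ, hc⟩
      · exact (hnone _ hq.1 hx).elim
      · obtain ⟨k, h0, _, _, ha⟩ := hiter σ hσ
        rw [hc] at hx
        exact ha 0 h0 x hx
    · exact ha 0 h0 x hx

end

/-! ### Breadth-first search -/

section
variable {n : ℕ} {G : Digraph (Fin n)} {adj : Fin n → List (Fin n)}

theorem inputNbr_spec (hadj : IsAdjLists G adj) {v p : ℕ} (hv : v < n)
    (hp : p < inputDeg adj v) :
    ∃ h : inputNbr adj v p < n, G.Adj ⟨v, hv⟩ ⟨inputNbr adj v p, h⟩ := by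
  simp only [inputDeg, hv, dite_true] at hp
  have h1 : inputNbr adj v p = ((adj ⟨v, hv⟩)[p] : ℕ) := by
    simp [inputNbr, hv, List.getElem?_eq_getElem hp]
  refine ⟨h1 ▸ Fin.is_lt _, ?_⟩
  rw [← (hadj ⟨v, hv⟩).2]
  convert List.getElem_mem hp

theorem exists_inputNbr_eq (hadj : IsAdjLists G adj) {v u : Fin n} (h : G.Adj v u) :
    ∃ p < inputDeg adj v, inputNbr adj v p = u := by
  rw [← (hadj v).2] at h
  obtain ⟨p, hp, rfl⟩ := List.getElem_of_mem h
  refine ⟨p, by simpa [inputDeg] using hp, ?_⟩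
  simp [inputNbr, List.getElem?_eq_getElem hp]

theorem inputDeg_eq_degree (hadj : IsAdjLists G adj) (v : Fin n) :
    inputDeg adj v = degree G v := by
  classical
  have h : {u | G.Adj v u} = ((adj v).toFinset : Set (Fin n)) := by
    ext u; simp [(hadj v).2]
  rw [degree, h, Set.ncard_coe_finset, List.toFinset_card_of_nodup (hadj v).1]
  simp [inputDeg]

theorem inputDeg_le (hadj : IsAdjLists G adj) (v : ℕ) : inputDeg adj v ≤ n := by
  unfold inputDeg
  split
  · simpa using (hadj _).1.length_le_card
  · exact Nat.zero_le _

/-- The sum of the degrees of the vertices below `k`. -/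
def degSum (adj : Fin n → List (Fin n)) (k : ℕ) : ℕ := ∑ v ∈ Finset.range k, inputDeg adj v

theorem degSum_mono : Monotone (degSum adj) := fun _ _ h =>
  Finset.sum_le_sum_of_subset (by simpa using h)

theorem degSum_le (hadj : IsAdjLists G adj) (k : ℕ) : degSum adj k ≤ k * n := by
  have := Finset.sum_le_card_nsmul (Finset.range k) (inputDeg adj) n
    (fun v _ => inputDeg_le hadj v)
  simpa [degSum] using this

theorem degSum_eq (hadj : IsAdjLists G adj) :
    (degSum adj n : ℝ) = ∑ v, (degree G v : ℝ) := by
  rw [degSum, Finset.sum_range]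
  push_cast
  exact Finset.sum_congr rfl fun v _ => by rw [inputDeg_eq_degree hadj]

/-- `HasWalk` for vertices given as natural numbers. -/
def WalkN (G : Digraph (Fin n)) (k s t : ℕ) : Prop :=
  ∃ (hs : s < n) (ht : t < n), HasWalk G k ⟨s, hs⟩ ⟨t, ht⟩

/-- `dist` for vertices given as natural numbers, `⊤` if they are not vertices. -/
noncomputable def distN (G : Digraph (Fin n)) (s t : ℕ) : ℕ∞ :=
  if h : s < n ∧ t < n then dist G ⟨s, h.1⟩ ⟨t, h.2⟩ else ⊤

/-- The word `d` represents the distance `x` between two of `n` vertices. As finite distances are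
below `n`, the word `n` stands for `⊤`. -/
def IsCode (n d : ℕ) (x : ℕ∞) : Prop := (d = n ∧ x = ⊤) ∨ (d < n ∧ x = d)

theorem distN_self {v : ℕ} (hv : v < n) : distN G v v = 0 := by
  simp only [distN, hv, and_self, dite_true, dist]
  exact le_antisymm (iInf₂_le (0 : ℕ) (show HasWalk G 0 _ _ from rfl)) bot_le

/-- The invariant of breadth-first search from `s`. The table `D` holds the distances found so far,
and `n` for vertices not yet reached. The queue `q` has received `tail` vertices, of which `head`
have been taken out. The last of these, `q (head - 1)` (if `head > 0`), has degree `du` and is being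
scanned up to position `e` of its list; vertices reached from it are put at depth `dd`. -/
structure Search (G : Digraph (Fin n)) (adj : Fin n → List (Fin n)) (s : ℕ) (D q : ℕ → ℕ)
    (head tail e du dd : ℕ) : Prop where
  head_le : head ≤ tail
  tail_pos : 0 < tail
  q_zero : q 0 = s
  q_lt : ∀ a < tail, q a < n
  q_inj : ∀ a b, a < b → b < tail → q a ≠ q b
  reached : ∀ v < n, D v = n ∨ ∃ a < tail, q a = v
  depth : ∀ a < tail, D (q a) ≤ a
  mono : ∀ a b, a ≤ b → b < tail → D (q a) ≤ D (q b)
  le_dd : ∀ a < tail, D (q a) ≤ dd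
  walk : ∀ a < tail, WalkN G (D (q a)) s (q a)
  e_le : e ≤ du
  du_zero : head = 0 → du = 0
  dd_zero : head = 0 → dd = 0
  cur : 0 < head → du = inputDeg adj (q (head - 1)) ∧ dd = D (q (head - 1)) + 1
  scanned : ∀ a < head, ∀ p < inputDeg adj (q a), (a + 1 < head ∨ p < e) →
    D (inputNbr adj (q a) p) ≠ n ∧ D (inputNbr adj (q a) p) ≤ D (q a) + 1

namespace Search
variable {s head tail e du dd : ℕ} {D q : ℕ → ℕ}

theorem tail_le (h : Search G adj s D q head tail e du dd) : tail ≤ n := by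
  have := Finset.card_le_card_of_injOn (s := Finset.range tail) (t := Finset.range n) q
    (fun a ha => by simpa using h.q_lt a (by simpa using ha)) (fun a ha b hb hab => by
      simp only [Finset.coe_range, Set.mem_Iio] at ha hb
      rcases lt_trichotomy a b with h1 | h1 | h1
      · exact (h.q_inj a b h1 hb hab).elim
      · exact h1
      · exact (h.q_inj b a h1 ha hab.symm).elim)
  simpa using this

/-- The work done, counted in vertices taken out and edges to be scanned, is bounded. -/
theorem work_le (h : Search G adj s D q head tail e du dd) :
    head + ∑ a ∈ Finset.range head, inputDeg adj (q a) ≤ n + degSum adj n := by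
  refine Nat.add_le_add (h.head_le.trans h.tail_le) ?_
  have hinj : Set.InjOn q (Finset.range head) := by
    intro a ha b hb hab
    simp only [Finset.coe_range, Set.mem_Iio] at ha hb
    rcases lt_trichotomy a b with h1 | h1 | h1
    · exact (h.q_inj a b h1 (hb.trans_le h.head_le) hab).elim
    · exact h1
    · exact (h.q_inj b a h1 (ha.trans_le h.head_le) hab.symm).elim
  rw [← Finset.sum_image (f := inputDeg adj) hinj]
  refine Finset.sum_le_sum_of_subset fun v hv => ?_
  obtain ⟨a, ha, rfl⟩ := Finset.mem_image.1 hv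
  exact Finset.mem_range.2 (h.q_lt a ((Finset.mem_range.1 ha).trans_le h.head_le))

theorem start (hs : s < n) (hq : q 0 = s) (hD : ∀ v < n, D v = if v = s then 0 else n) :
    Search G adj s D q 0 1 0 0 0 := by
  have h0 : ∀ a < 1, q a = s := fun a ha => by
    obtain rfl : a = 0 := by omega
    exact hq
  have hDs : D s = 0 := by simp [hD s hs]
  refine ⟨by omega, by omega, hq, fun a ha => by rw [h0 a ha]; exact hs, by omega, ?_, ?_, ?_, ?_,
    ?_, le_rfl, fun _ => rfl, fun _ => rfl, by omega, by omega⟩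
  · intro v hv
    by_cases hvs : v = s
    · exact Or.inr ⟨0, by omega, by rw [hq, hvs]⟩
    · exact Or.inl (by simp [hD v hv, hvs])
  · intro a ha; rw [h0 a ha, hDs]; exact Nat.zero_le _
  · intro a b _ hb; rw [h0 a (by omega), h0 b hb]
  · intro a ha; rw [h0 a ha, hDs]
  · intro a ha; rw [h0 a ha, hDs]; exact ⟨hs, hs, rfl⟩

theorem ne_of_lt_tail (h : Search G adj s D q head tail e du dd) {a : ℕ} (ha : a < tail) :
    D (q a) ≠ n :=
  ((h.depth a ha).trans_lt (ha.trans_le h.tail_le)).ne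

theorem head_pos (h : Search G adj s D q head tail e du dd) (he : e < du) : 0 < head := by
  rcases Nat.eq_zero_or_pos head with h0 | h0
  · rw [h.du_zero h0] at he; omega
  · exact h0

theorem dd_le (h : Search G adj s D q head tail e du dd) (h0 : 0 < head) : dd ≤ head := by
  have h1 := h.depth (head - 1) (by have := h.head_le; omega)
  have h2 := (h.cur h0).2
  omega

theorem nbr_lt (h : Search G adj s D q head tail e du dd) (hadj : IsAdjLists G adj)
    (he : e < du) : inputNbr adj (q (head - 1)) e < n := by
  have h0 := h.head_pos he
  have h1 := h.head_le
  exact (inputNbr_spec hadj (h.q_lt (head - 1) (by omega)) ((h.cur h0).1 ▸ he)).1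

/-- Scanning an edge to a vertex already reached: its depth is at most `dd`, as is that of every
vertex in the queue. -/
theorem scan_old (h : Search G adj s D q head tail e du dd) (hadj : IsAdjLists G adj)
    (he : e < du) (hx : D (inputNbr adj (q (head - 1)) e) ≠ n) :
    Search G adj s D q head tail (e + 1) du dd := by
  refine { h with e_le := he, scanned := ?_ }
  intro a ha p hp hor
  by_cases hlt : a + 1 < head ∨ p < e
  · exact h.scanned a ha p hp hlt
  · obtain rfl : p = e := by omega
    obtain rfl : a = head - 1 := by omega
    refine ⟨hx, ?_⟩
    rcases h.reached _ (h.nbr_lt hadj he) with h1 | ⟨b, hb, h1⟩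
    · exact (hx h1).elim
    · rw [← h1, ← (h.cur (by omega)).2]
      exact h.le_dd b hb

/-- Scanning an edge to a new vertex `x`, which enters the table with depth `dd` and the queue at
its end. The new table and queue are only compared with the old ones below `n`. -/
theorem scan_new (h : Search G adj s D q head tail e du dd) (hadj : IsAdjLists G adj)
    (he : e < du) {x : ℕ} (hx : x = inputNbr adj (q (head - 1)) e) (hDx : D x = n) {D' q' : ℕ → ℕ}
    (hD' : ∀ v < n, D' v = if v = x then dd else D v)
    (hq' : ∀ a < n, q' a = if a = tail then x else q a) :
    tail < n ∧ Search G adj s D' q' head (tail + 1) (e + 1) du dd := by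
  have h0 := h.head_pos he
  have hht := h.head_le
  have hxn : x < n := hx ▸ h.nbr_lt hadj he
  have hnew : ∀ a < tail, q a ≠ x := fun a ha hax => h.ne_of_lt_tail ha (hax ▸ hDx)
  -- the old queue together with `x` still has no repetitions
  have htn : tail < n := by
    have := Finset.card_le_card_of_injOn (s := Finset.range (tail + 1)) (t := Finset.range n)
      (fun a => if a = tail then x else q a)
      (fun a ha => by
        simp only [Finset.coe_range, Set.mem_Iio] at ha ⊢
        split
        · exact hxn
        · exact h.q_lt a (by omega))
      (fun a ha b hb hab => by
        simp only [Finset.coe_range, Set.mem_Iio] at ha hb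
        by_contra hne
        by_cases h1 : a = tail <;> by_cases h2 : b = tail <;> simp only [h1, h2, if_true,
          if_false] at hab
        · omega
        · exact hnew b (by omega) hab.symm
        · exact hnew a (by omega) hab
        · rcases Nat.lt_or_gt_of_ne hne with h3 | h3
          · exact h.q_inj a b h3 (by omega) hab
          · exact h.q_inj b a h3 (by omega) hab.symm)
    simpa using this
  have hq : ∀ a < tail, q' a = q a := fun a ha => by
    rw [hq' a (by omega), if_neg (by omega)]
  have hqt : q' tail = x := by rw [hq' tail htn, if_pos rfl]
  have hD : ∀ a < tail, D' (q a) = D (q a) := fun a ha => by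
    rw [hD' _ (h.q_lt a ha), if_neg (hnew a ha)]
  have hDx' : D' x = dd := by rw [hD' x hxn, if_pos rfl]
  have hdd : dd = D (q (head - 1)) + 1 := (h.cur h0).2
  refine ⟨htn, by omega, by omega, ?_, ?_, ?_, ?_, ?_, ?_, ?_, ?_, he, by omega, by omega, ?_, ?_⟩
  · rw [hq 0 h.tail_pos, h.q_zero]
  · intro a ha
    rcases Nat.lt_succ_iff_lt_or_eq.1 ha with h1 | rfl
    · rw [hq a h1]; exact h.q_lt a h1
    · rwa [hqt]
  · intro a b hab hb
    rw [hq a (by omega)]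
    rcases Nat.lt_succ_iff_lt_or_eq.1 hb with h1 | rfl
    · rw [hq b h1]; exact h.q_inj a b hab h1
    · rw [hqt]; exact hnew a hab
  · intro v hv
    by_cases hvx : v = x
    · exact Or.inr ⟨tail, by omega, by rw [hqt, hvx]⟩
    · rw [hD' v hv, if_neg hvx]
      refine (h.reached v hv).imp id ?_
      rintro ⟨a, ha, h1⟩
      exact ⟨a, by omega, by rw [hq a ha, h1]⟩
  · intro a ha
    rcases Nat.lt_succ_iff_lt_or_eq.1 ha with h1 | rfl
    · rw [hq a h1, hD a h1]; exact h.depth a h1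
    · rw [hqt, hDx']; exact (h.dd_le h0).trans hht
  · intro a b hab hb
    rcases Nat.lt_succ_iff_lt_or_eq.1 hb with h1 | rfl
    · rw [hq a (by omega), hq b h1, hD a (by omega), hD b h1]; exact h.mono a b hab h1
    · rcases hab.lt_or_eq with h2 | rfl
      · rw [hq a h2, hqt, hDx', hD a h2]; exact h.le_dd a h2
      · exact le_rfl
  · intro a ha
    rcases Nat.lt_succ_iff_lt_or_eq.1 ha with h1 | rfl
    · rw [hq a h1, hD a h1]; exact h.le_dd a h1
    · rw [hqt, hDx']
  · intro a ha
    rcases Nat.lt_succ_iff_lt_or_eq.1 ha with h1 | rfl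
    · rw [hq a h1, hD a h1]; exact h.walk a h1
    · rw [hqt, hDx', hdd]
      obtain ⟨h1, h2, h3⟩ := h.walk (head - 1) (by omega)
      obtain ⟨h4, h5⟩ := inputNbr_spec hadj h2 ((h.cur h0).1 ▸ he)
      subst hx
      exact ⟨h1, h4, _, h3, h5⟩
  · intro _
    rw [hq _ (by omega), hD _ (by omega)]
    exact h.cur h0
  · intro a ha p hp hor
    rw [hq a (by omega)] at hp ⊢
    rw [hD a (by omega)]
    obtain ⟨h1, _⟩ := inputNbr_spec hadj (h.q_lt a (by omega)) hp
    rw [hD' _ h1]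
    by_cases hlt : a + 1 < head ∨ p < e
    · obtain ⟨h2, h3⟩ := h.scanned a ha p hp hlt
      rw [if_neg (by rintro rfl; exact h2 hDx)]
      exact ⟨h2, h3⟩
    · obtain rfl : p = e := by omega
      obtain rfl : a = head - 1 := by omega
      rw [if_pos hx.symm]
      have := h.dd_le h0
      omega

/-- Taking the next vertex out of the queue when all edges of the last one have been scanned. -/
theorem dequeue (h : Search G adj s D q head tail e du dd) (he : ¬ e < du) (hlt : head < tail) :
    Search G adj s D q (head + 1) tail 0 (inputDeg adj (q head)) (D (q head) + 1) := by
  refine { h with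
    head_le := hlt
    le_dd := ?_
    e_le := Nat.zero_le _
    du_zero := by omega
    dd_zero := by omega
    cur := fun _ => ⟨rfl, rfl⟩
    scanned := ?_ }
  · intro a ha
    rcases Nat.eq_zero_or_pos head with h0 | h0
    · have h1 := h.le_dd a ha
      have h2 := h.dd_zero h0
      omega
    · have h1 := h.le_dd a ha
      have h2 := (h.cur h0).2
      have h3 := h.mono (head - 1) head (by omega) hlt
      omega
  · intro a ha p hp hor
    rcases Nat.lt_succ_iff_lt_or_eq.1 ha with h1 | rfl
    · refine h.scanned a h1 p hp ?_
      by_cases h2 : a + 1 < head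
      · exact Or.inl h2
      · right
        obtain rfl : a = head - 1 := by omega
        rw [(h.cur (by omega)).1] at he
        omega
    · omega

/-- When the queue is empty, the table holds the distances. -/
theorem finish (h : Search G adj s D q tail tail e du dd) (hadj : IsAdjLists G adj)
    (he : ¬ e < du) {t : ℕ} (ht : t < n) : IsCode n (D t) (distN G s t) := by
  have hs : s < n := h.q_zero ▸ h.q_lt 0 h.tail_pos
  have hD0 : D s = 0 := by
    have := h.depth 0 h.tail_pos
    rw [h.q_zero] at this
    omega
  -- along a walk the table grows by at most one per edge
  have key : ∀ k (v : Fin n), HasWalk G k ⟨s, hs⟩ v → D v ≠ n ∧ D v ≤ k := by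
    intro k
    induction k with
    | zero =>
      rintro v hv
      have hv : (⟨s, hs⟩ : Fin n) = v := hv
      subst hv
      rw [hD0]
      exact ⟨by omega, le_rfl⟩
    | succ k ih =>
      rintro v ⟨u, hu, huv⟩
      obtain ⟨h1, h2⟩ := ih u hu
      rcases h.reached u u.2 with h3 | ⟨a, ha, h3⟩
      · exact (h1 h3).elim
      · obtain ⟨p, hp, h4⟩ := exists_inputNbr_eq hadj huv
        rw [← h3] at hp h4
        have h5 := h.scanned a ha p hp (by
          by_cases h6 : a + 1 < tail
          · exact Or.inl h6
          · right
            obtain rfl : a = tail - 1 := by omega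
            rw [(h.cur (by omega)).1] at he
            omega)
        rw [h4, h3] at h5
        exact ⟨h5.1, by omega⟩
  have hdist : distN G s t = dist G ⟨s, hs⟩ ⟨t, ht⟩ := by simp [distN, hs, ht]
  rw [hdist]
  rcases h.reached t ht with h1 | ⟨a, ha, h1⟩
  · refine Or.inl ⟨h1, ?_⟩
    simp only [dist, iInf_eq_top]
    intro k hk
    exact ((key k _ hk).1 h1).elim
  · right
    subst h1
    refine ⟨(h.depth a ha).trans_lt (ha.trans_le h.tail_le), ?_⟩
    obtain ⟨_, _, hw⟩ := h.walk a ha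
    refine le_antisymm (iInf₂_le (D (q a)) hw) (le_iInf₂ fun k hk => ?_)
    exact_mod_cast (key k _ hk).2

end Search

end

/-! ### The program -/

/-! Names of registers. The search uses the registers from 20 on. -/
namespace Reg
abbrev zero : ℕ := 0
abbrev one : ℕ := 1
abbrev three : ℕ := 2
/-- the number of vertices -/
abbrev n : ℕ := 3
/-- the address of the queue -/
abbrev queue : ℕ := 4
/-- what the loop body does: 0 adds up degrees, 1 divides, 2 searches and emits distances -/
abbrev mode : ℕ := 5
/-- becomes 1 when the output is complete -/
abbrev done : ℕ := 6
/-- the number of edges counted, then the remainder of its division by `n` -/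
abbrev edges : ℕ := 7
/-- the next vertex whose degree is to be added -/
abbrev vertex : ℕ := 8
abbrev tmp : ℕ := 9
/-- the source of the current search -/
abbrev src : ℕ := 10
/-- the next target for which a triple is emitted -/
abbrev target : ℕ := 11
/-- the number of search steps since the target changed -/
abbrev tick : ℕ := 12
/-- the number of search steps per target -/
abbrev quota : ℕ := 13
/-- the address of the distances from the previous source -/
abbrev prev : ℕ := 14
/-- the address of the distances from the current source -/
abbrev cur : ℕ := 15
abbrev prevSrc : ℕ := 16
abbrev outAddr : ℕ := 17
abbrev outVal : ℕ := 18
/-- the next entry of the distance table to be initialized -/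
abbrev init : ℕ := 20
abbrev head : ℕ := 21
abbrev tail : ℕ := 22
/-- the position in the adjacency list of `scan` -/
abbrev pos : ℕ := 23
abbrev scanDeg : ℕ := 24
/-- the depth of the vertices reached from `scan` -/
abbrev depth : ℕ := 25
/-- the vertex whose edges are being scanned -/
abbrev scan : ℕ := 26
abbrev nbr : ℕ := 27
abbrev addr : ℕ := 28
abbrev val : ℕ := 29
end Reg

/-- A sequence of commands. -/
def Cmd.block : List Cmd → Cmd
  | [] => .skip
  | [c] => c
  | c :: d :: l => .seq c (Cmd.block (d :: l))

open Cmd Instr in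
/-- One step of the search: initialize one entry of the table, or scan one edge, or take one vertex
out of the queue, or do nothing if the search is complete. -/
def searchStep : Cmd :=
  .ifLt Reg.init Reg.n
    (block [
      atom (add Reg.addr Reg.cur Reg.init),
      .ifEq Reg.init Reg.src
        (atom (store Reg.addr Reg.zero))
        (atom (store Reg.addr Reg.n)),
      atom (add Reg.init Reg.init Reg.one)])
    (.ifLt Reg.pos Reg.scanDeg
      (block [
        atom (Instr.nbr Reg.nbr Reg.scan Reg.pos),
        atom (add Reg.pos Reg.pos Reg.one),
        atom (add Reg.addr Reg.cur Reg.nbr),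
        atom (load Reg.val Reg.addr),
        .ifEq Reg.val Reg.n
          (block [
            atom (store Reg.addr Reg.depth),
            atom (add Reg.addr Reg.queue Reg.tail),
            atom (store Reg.addr Reg.nbr),
            atom (add Reg.tail Reg.tail Reg.one)])
          skip])
      (.ifLt Reg.head Reg.tail
        (block [
          atom (add Reg.addr Reg.queue Reg.head),
          atom (load Reg.scan Reg.addr),
          atom (add Reg.head Reg.head Reg.one),
          atom (deg Reg.scanDeg Reg.scan),
          atom (const Reg.pos 0),
          atom (add Reg.addr Reg.cur Reg.scan),
          atom (load Reg.depth Reg.addr),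
          atom (add Reg.depth Reg.depth Reg.one)])
        skip))

section
variable {n : ℕ} {G : Digraph (Fin n)} {adj : Fin n → List (Fin n)}

/-- The state `σ` is that of a search from `s` with distance table at address `c`, `steps` steps
after its start, where idle steps after its completion count as well. -/
def SearchInv (G : Digraph (Fin n)) (adj : Fin n → List (Fin n)) (s c steps : ℕ) (σ : State) :
    Prop :=
  (σ.reg Reg.init < n ∧ σ.reg Reg.head = 0 ∧ σ.reg Reg.tail = 1 ∧ σ.reg Reg.pos = 0 ∧
    σ.reg Reg.scanDeg = 0 ∧ σ.reg Reg.depth = 0 ∧ σ.mem (2 * n) = s ∧ steps = σ.reg Reg.init ∧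
    ∀ v < σ.reg Reg.init, σ.mem (c + v) = if v = s then 0 else n) ∨
  (σ.reg Reg.init = n ∧
    Search G adj s (fun v => σ.mem (c + v)) (fun a => σ.mem (2 * n + a)) (σ.reg Reg.head)
      (σ.reg Reg.tail) (σ.reg Reg.pos) (σ.reg Reg.scanDeg) (σ.reg Reg.depth) ∧
    (0 < σ.reg Reg.head → σ.reg Reg.scan = σ.mem (2 * n + (σ.reg Reg.head - 1))) ∧
    (steps + σ.reg Reg.scanDeg = n + σ.reg Reg.head +
        ∑ a ∈ Finset.range (σ.reg Reg.head), inputDeg adj (σ.mem (2 * n + a)) + σ.reg Reg.pos ∨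
      (¬ σ.reg Reg.pos < σ.reg Reg.scanDeg ∧ σ.reg Reg.head = σ.reg Reg.tail)))

/-- After enough steps the search is complete. -/
theorem SearchInv.isCode {s c steps : ℕ} {σ : State} (h : SearchInv G adj s c steps σ)
    (hadj : IsAdjLists G adj) (hsteps : 2 * n + degSum adj n < steps) {t : ℕ} (ht : t < n) :
    IsCode n (σ.mem (c + t)) (distN G s t) := by
  rcases h with h | ⟨_, h2, _, h4 | ⟨h4, h5⟩⟩
  · omega
  · have := h2.work_le
    have := h2.e_le
    omega
  · rw [h5] at h2
    exact h2.finish hadj h4 ht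

/-- A search step preserves the invariant, and it leaves the other registers and the table of the
previous source alone. -/
theorem wp_searchStep (hadj : IsAdjLists G adj) {W s c steps : ℕ} {σ : State}
    (hW : 4 * n + 4 ≤ W) (hzero : σ.reg Reg.zero = 0) (hone : σ.reg Reg.one = 1)
    (hn : σ.reg Reg.n = n) (hqueue : σ.reg Reg.queue = 2 * n) (hs : s < n)
    (hsrc : σ.reg Reg.src = s) (hcur : σ.reg Reg.cur = c) (hc : c = 0 ∨ c = n)
    (h : SearchInv G adj s c steps σ) :
    searchStep.wp W (3 * n) adj (fun σ' => SearchInv G adj s c (steps + 1) σ' ∧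
      σ'.out = σ.out ∧ (∀ r < 20, σ'.reg r = σ.reg r) ∧
      ∀ x < 2 * n, x < c ∨ c + n ≤ x → σ'.mem x = σ.mem x) σ := by
  obtain ⟨reg, mem, out⟩ := σ
  simp only [Reg.zero, Reg.one, Reg.n, Reg.queue, Reg.src, Reg.cur, SearchInv, Reg.init, Reg.head,
    Reg.tail, Reg.pos, Reg.scanDeg, Reg.depth, Reg.scan] at *
  simp only [searchStep, Cmd.block, Cmd.wp, wpInstr, State.set, hn, Reg.zero, Reg.one, Reg.n,
    Reg.queue, Reg.src, Reg.cur, Reg.init, Reg.head, Reg.tail, Reg.pos, Reg.scanDeg, Reg.depth,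
    Reg.scan, Reg.nbr, Reg.addr, Reg.val]
  refine ⟨fun hinit => ?_, fun hinit => ⟨fun hpos => ?_, fun hpos => ⟨fun hht => ?_,
    fun hht => ?_⟩⟩⟩
  · obtain ⟨-, h1, h2, h3, h4, h5, h6, h7, h8⟩ := h.resolve_right (by omega)
    simp only [Function.update_apply, hcur, hsrc, hzero, hone, hn, Nat.reduceEqDiff, if_false,
      if_true, h1, h2, h3, h4, h5, Nat.add_right_cancel_iff, Nat.add_left_cancel_iff]
    refine ⟨by omega, fun his => ⟨by omega, by omega, ?_, trivial, fun r hr => by grind,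
      fun x hx hxc => if_neg (by omega)⟩, fun his => ⟨by omega, by omega, ?_, trivial,
      fun r hr => by grind, fun x hx hxc => if_neg (by omega)⟩⟩
    all_goals
      rcases Nat.lt_or_ge (reg 20 + 1) n with hlt | hge
      · left
        refine ⟨hlt, trivial, trivial, trivial, trivial, trivial, ?_, by omega, fun v hv => ?_⟩
        · rw [if_neg (by omega), h6]
        · grind
      · right
        refine ⟨by omega, Search.start hs ?_ fun v hv => ?_, by omega, Or.inl ?_⟩
        · rw [if_neg (by omega)]; exact h6
        · grind
        · simp; omega
  · obtain ⟨h1, h2, h3, h4⟩ := h.resolve_left (by omega)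
    have h0 := h2.head_pos hpos
    have hx := h2.nbr_lt hadj hpos
    have hdeg := (h2.cur h0).1
    have hdegn := inputDeg_le hadj (mem (2 * n + (reg 21 - 1)))
    have htail := h2.tail_le
    have hht := h2.head_le
    have hscan := h3 h0
    rw [← hscan] at hdegn hdeg hx
    have hold := h2.scan_old hadj hpos
    have hnew := fun D' q' => h2.scan_new hadj hpos (x := inputNbr adj (reg 26) (reg 23))
      (by rw [hscan]) (D' := D') (q' := q')
    rw [← hscan] at hold
    simp only [Function.update_apply, hcur, hone, hn, hqueue, Nat.reduceEqDiff, if_false,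
      if_true, Nat.add_left_cancel_iff]
    generalize hxdef : inputNbr adj (reg 26) (reg 23) = x at *
    have hmem : mem (c + x) ≤ n := by
      rcases h2.reached x hx with h | ⟨a, ha, rfl⟩
      · exact h.le
      · exact (h2.depth a ha).trans (ha.le.trans htail)
    refine ⟨by omega, by omega, by omega, by omega, by omega, fun hD => ?_, fun hD => ?_⟩
    · obtain ⟨htn, hS⟩ := hnew
        (fun v => if c + v = 2 * n + reg 22 then x else if v = x then reg 25 else mem (c + v))
        (fun a => if a = reg 22 then x else if 2 * n + a = c + x then reg 25 else mem (2 * n + a))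
        hD (fun v hv => if_neg (by omega)) (fun a ha => by
          rw [if_neg (c := 2 * n + a = c + x) (by omega)])
      refine ⟨by omega, by omega, by omega, by omega, Or.inr ⟨h1, hS, fun _ => ?_, ?_⟩, trivial,
        fun r hr => by grind, fun y hy hyc => ?_⟩
      · rw [if_neg (by omega), if_neg (by omega), h3 h0]
      · refine Or.inl ?_
        have hsum : ∑ a ∈ Finset.range (reg 21), inputDeg adj (if a = reg 22 then x else
            if 2 * n + a = c + x then reg 25 else mem (2 * n + a)) =
            ∑ a ∈ Finset.range (reg 21), inputDeg adj (mem (2 * n + a)) :=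
          Finset.sum_congr rfl fun a ha => by
            have := Finset.mem_range.1 ha
            rw [if_neg (by omega), if_neg (by omega)]
        rw [hsum]
        omega
      · rw [if_neg (by omega), if_neg (by omega)]
    · exact ⟨Or.inr ⟨h1, hold hD, h3, by omega⟩, trivial, fun r hr => by grind,
        fun _ _ _ => trivial⟩
  · obtain ⟨h1, h2, h3, h4⟩ := h.resolve_left (by omega)
    have htail := h2.tail_le
    have hu := h2.q_lt _ hht
    have hdegn := inputDeg_le hadj (mem (2 * n + reg 21))
    have hdep := h2.depth _ hht
    have hS := h2.dequeue hpos hht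
    have he := h2.e_le
    simp only [Function.update_apply, hcur, hone, hqueue, Nat.reduceEqDiff, if_false, if_true]
    refine ⟨by omega, by omega, by omega, by omega, by omega, by omega, by omega, by omega,
      by omega, by omega, Or.inr ⟨h1, hS, fun _ => rfl, Or.inl ?_⟩, trivial, fun r hr => by grind,
      fun _ _ _ => trivial⟩
    rw [Finset.sum_range_succ]
    omega
  · obtain ⟨h1, h2, h3, h4⟩ := h.resolve_left (by omega)
    have := h2.head_le
    exact ⟨Or.inr ⟨h1, h2, h3, Or.inr ⟨hpos, by omega⟩⟩, trivial, fun _ _ => trivial,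
      fun _ _ _ => trivial⟩

end

open Cmd Instr in
/-- Add the degrees of the next two vertices, or of the next one if it is the last. -/
def countPair : Cmd :=
  block [
    atom (deg Reg.tmp Reg.vertex),
    atom (add Reg.edges Reg.edges Reg.tmp),
    atom (add Reg.vertex Reg.vertex Reg.one),
    .ifLt Reg.vertex Reg.n
      (block [
        atom (deg Reg.tmp Reg.vertex),
        atom (add Reg.edges Reg.edges Reg.tmp),
        atom (add Reg.vertex Reg.vertex Reg.one)])
      skip]

open Cmd Instr in
/-- Count the edges that leave the next two vertices and emit one triple `(v, v, 0)`. -/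
def countStep : Cmd :=
  block [
    countPair,
    atom (emit Reg.target Reg.target Reg.zero),
    atom (add Reg.target Reg.target Reg.one),
    .ifLt Reg.vertex Reg.n
      skip
      (block [
        atom (const Reg.mode 1),
        .ifEq Reg.target Reg.n (atom (const Reg.done 1)) skip])]

open Cmd Instr in
/-- One step of the division of the number of edges by `n`. -/
def divStep : Cmd :=
  .ifLt Reg.edges Reg.n
    (atom (const Reg.mode 2))
    (block [
      atom (sub Reg.edges Reg.edges Reg.n),
      atom (add Reg.quota Reg.quota Reg.three)])

open Cmd Instr in
/-- Emit the triple for the current target: a trivial one during the search from the first source,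
and later the one with the distance from the previous source, unless it is trivial. -/
def emitStep : Cmd :=
  .ifEq Reg.src Reg.zero
    (atom (emit Reg.target Reg.target Reg.zero))
    (block [
      atom (sub Reg.prevSrc Reg.src Reg.one),
      .ifEq Reg.target Reg.prevSrc
        skip
        (block [
          atom (add Reg.outAddr Reg.prev Reg.target),
          atom (load Reg.outVal Reg.outAddr),
          .ifEq Reg.outVal Reg.n
            (atom (emitTop Reg.prevSrc Reg.target))
            (atom (emit Reg.prevSrc Reg.target Reg.outVal))])])

open Cmd Instr in
/-- Proceed to the search from the next source, and exchange the two distance tables. -/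
def nextSource : Cmd :=
  block [
    atom (const Reg.target 0),
    atom (add Reg.src Reg.src Reg.one),
    atom (copy Reg.tmp Reg.prev),
    atom (copy Reg.prev Reg.cur),
    atom (copy Reg.cur Reg.tmp),
    atom (const Reg.init 0),
    atom (const Reg.head 0),
    atom (const Reg.tail 1),
    atom (const Reg.pos 0),
    atom (const Reg.scanDeg 0),
    atom (const Reg.depth 0),
    atom (store Reg.queue Reg.src),
    .ifLt Reg.n Reg.src (atom (const Reg.done 1)) skip]

open Cmd Instr in
/-- One step of the search, and after every `quota` of these the triple for one target. -/
def mainStep : Cmd :=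
  block [
    .ifLt Reg.src Reg.n searchStep skip,
    atom (add Reg.tick Reg.tick Reg.one),
    .ifLt Reg.tick Reg.quota
      skip
      (block [
        atom (const Reg.tick 0),
        emitStep,
        atom (add Reg.target Reg.target Reg.one),
        .ifLt Reg.target Reg.n skip nextSource])]

/-- The body of the loop. -/
def loopBody : Cmd :=
  .ifEq Reg.mode Reg.zero countStep (.ifEq Reg.mode Reg.one divStep mainStep)

open Cmd Instr in
/-- The initialization of the registers and of the queue. -/
def prelude : Cmd :=
  block [
    atom (order Reg.n),
    atom (add Reg.queue Reg.n Reg.n),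
    atom (const Reg.zero 0),
    atom (store Reg.queue Reg.zero),
    atom (const Reg.one 1),
    atom (const Reg.three 3),
    atom (const Reg.mode 0),
    atom (const Reg.done 0),
    atom (const Reg.edges 0),
    atom (const Reg.vertex 0),
    atom (const Reg.src 0),
    atom (const Reg.target 0),
    atom (const Reg.tick 0),
    atom (const Reg.quota 12),
    atom (const Reg.prev 0),
    atom (copy Reg.cur Reg.n),
    atom (const Reg.init 0),
    atom (const Reg.head 0),
    atom (const Reg.tail 1),
    atom (const Reg.pos 0),
    atom (const Reg.scanDeg 0),
    atom (const Reg.depth 0)]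

/-- The program that enumerates all distances. -/
def enumProgram : Program := loopProgram prelude loopBody Reg.done Reg.one

/-! ### The order of the output -/

section
variable {n : ℕ} {G : Digraph (Fin n)} {adj : Fin n → List (Fin n)}

/-- The triples emitted until the program comes to target `j` with current source `s`: the trivial
triples while `s = 0`, and those of source `s - 1` for `s > 0`. -/
noncomputable def outList (G : Digraph (Fin n)) : ℕ → ℕ → List (ℕ × ℕ × ℕ∞)
  | 0, j => (List.range j).map fun v => (v, v, 0)
  | s + 1, j => outList G s n ++
      ((List.range j).filter fun t => t ≠ s).map fun t => (s, t, distN G s t)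

theorem outList_zero_succ (j : ℕ) : outList G 0 (j + 1) = outList G 0 j ++ [(j, j, 0)] := by
  simp [outList, List.range_succ]

theorem outList_succ_self (s : ℕ) : outList G (s + 1) (s + 1) = outList G (s + 1) s := by
  simp [outList, List.range_succ]

theorem outList_succ_succ {s j : ℕ} (h : j ≠ s) :
    outList G (s + 1) (j + 1) = outList G (s + 1) j ++ [(s, j, distN G s j)] := by
  simp [outList, List.range_succ, h]

theorem outList_succ_zero (s : ℕ) : outList G (s + 1) 0 = outList G s n := by
  simp [outList]

theorem length_outList_le (s : ℕ) : ∀ {j : ℕ}, j ≤ n →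
    (outList G s j).length ≤ (s + 1) * n := by
  induction s with
  | zero => intro j hj; simpa [outList] using hj
  | succ s ih =>
    intro j hj
    have h1 := ih le_rfl
    have h2 : ((List.range j).filter fun t => t ≠ s).length ≤ n := by
      refine (List.length_filter_le _ _).trans ?_
      simpa using hj
    simp only [outList, List.length_append, List.length_map]
    rw [add_mul (s + 1)]
    omega

theorem mem_outList {s : ℕ} {x : ℕ × ℕ × ℕ∞} : x ∈ outList G s n ↔
    (∃ v < n, x = (v, v, 0)) ∨ ∃ a < s, ∃ t < n, t ≠ a ∧ x = (a, t, distN G a t) := by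
  induction s with
  | zero => simp [outList, eq_comm]
  | succ s ih =>
    simp only [outList, List.mem_append, ih, List.mem_map, List.mem_filter, List.mem_range,
      decide_eq_true_eq]
    constructor
    · rintro ((h | ⟨a, ha, h⟩) | ⟨t, ⟨ht, hts⟩, rfl⟩)
      · exact Or.inl h
      · exact Or.inr ⟨a, by omega, h⟩
      · exact Or.inr ⟨s, by omega, t, ht, hts, rfl⟩
    · rintro (h | ⟨a, ha, t, ht, hta, rfl⟩)
      · exact Or.inl (Or.inl h)
      · rcases Nat.lt_succ_iff_lt_or_eq.1 ha with h | rfl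
        · exact Or.inl (Or.inr ⟨a, h, t, ht, hta, rfl⟩)
        · exact Or.inr ⟨t, ⟨ht, hta⟩, rfl⟩

theorem nodup_outList (s : ℕ) : (outList G s n).Nodup := by
  induction s with
  | zero =>
    refine List.Nodup.map (fun a b h => ?_) List.nodup_range
    exact congrArg Prod.fst h
  | succ s ih =>
    refine List.Nodup.append ih ?_ ?_
    · refine List.Nodup.map (fun a b h => ?_) (List.nodup_range.filter _)
      exact congrArg (fun x => x.2.1) h
    · intro x hx hx'
      obtain ⟨t, ht, rfl⟩ := List.mem_map.1 hx'
      have hts : t ≠ s := by simpa using (List.mem_filter.1 ht).2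
      rcases mem_outList.1 hx with ⟨v, _, h⟩ | ⟨a, ha, t', _, _, h⟩ <;>
        simp only [Prod.mk.injEq] at h <;> omega

theorem isEnumeration_outList : IsEnumeration G (outList G n n) := by
  refine ⟨nodup_outList n, fun x => mem_outList.trans ⟨?_, ?_⟩⟩
  · rintro (⟨v, hv, rfl⟩ | ⟨a, ha, t, ht, _, rfl⟩)
    · refine ⟨⟨v, hv⟩, ⟨v, hv⟩, ?_⟩
      have := distN_self (G := G) hv
      simp only [distN, hv, and_self, dite_true] at this
      rw [this]
    · exact ⟨⟨a, ha⟩, ⟨t, ht⟩, by simp [distN, ha, ht]⟩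
  · rintro ⟨s, t, rfl⟩
    have hd : dist G s t = distN G s t := by simp [distN]
    by_cases hst : t = s
    · subst hst
      exact Or.inl ⟨t, t.2, by rw [hd, distN_self t.2]⟩
    · exact Or.inr ⟨s, s.2, t, t.2, fun h => hst (Fin.ext h), by rw [hd]⟩

/-! ### The loop invariant -/

/-- The number of search steps per target, about three times the average degree. -/
def quota (adj : Fin n → List (Fin n)) : ℕ := 12 + 3 * (degSum adj n / n)

theorem quota_le : quota adj ≤ 12 + 3 * degSum adj n := by
  have := Nat.div_le_self (degSum adj n) n
  unfold quota
  omega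

/-- A third of the targets suffices for a complete search. -/
theorem search_lt_mul_quota (hn : 0 < n) {k : ℕ} (hk : n ≤ 3 * k) :
    2 * n + degSum adj n < k * quota adj := by
  have h1 : k * quota adj = 3 * k * (4 + degSum adj n / n) := by unfold quota; ring
  have h2 : n * (4 + degSum adj n / n) ≤ k * quota adj := h1 ▸ Nat.mul_le_mul_right _ hk
  have h3 : degSum adj n < n * (degSum adj n / n + 1) := Nat.lt_mul_div_succ _ hn
  rw [mul_add] at h2 h3
  omega

theorem SearchInv.congr {s c steps : ℕ} {σ σ' : State} (h : SearchInv G adj s c steps σ)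
    (hr : ∀ r, 20 ≤ r → σ'.reg r = σ.reg r) (hm : σ'.mem = σ.mem) :
    SearchInv G adj s c steps σ' := by
  unfold SearchInv at h ⊢
  rwa [hm, hr Reg.init (by decide), hr Reg.head (by decide), hr Reg.tail (by decide),
    hr Reg.pos (by decide), hr Reg.scanDeg (by decide), hr Reg.depth (by decide),
    hr Reg.scan (by decide)]

theorem SearchInv.cast {s c steps steps' : ℕ} {σ : State} (h : SearchInv G adj s c steps σ)
    (hs : steps = steps') : SearchInv G adj s c steps' σ := hs ▸ h

theorem SearchInv.start {s c : ℕ} {σ : State} (hn : 0 < n) (h₁ : σ.reg Reg.init = 0)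
    (h₂ : σ.reg Reg.head = 0) (h₃ : σ.reg Reg.tail = 1) (h₄ : σ.reg Reg.pos = 0)
    (h₅ : σ.reg Reg.scanDeg = 0) (h₆ : σ.reg Reg.depth = 0) (h₇ : σ.mem (2 * n) = s) :
    SearchInv G adj s c 0 σ :=
  Or.inl ⟨h₁ ▸ hn, h₂, h₃, h₄, h₅, h₆, h₇, h₁.symm, by simp [h₁]⟩

/-- The registers that hold constants, and the loop condition. -/
structure Constants (n : ℕ) (σ : State) : Prop where
  zero : σ.reg Reg.zero = 0
  one : σ.reg Reg.one = 1
  three : σ.reg Reg.three = 3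
  order : σ.reg Reg.n = n
  queue : σ.reg Reg.queue = 2 * n
  done : σ.reg Reg.done = 0

/-- What holds before the main mode: the first search is about to start. -/
structure Preparing (G : Digraph (Fin n)) (adj : Fin n → List (Fin n)) (σ : State) : Prop where
  src : σ.reg Reg.src = 0
  tick : σ.reg Reg.tick = 0
  prev : σ.reg Reg.prev = 0
  cur : σ.reg Reg.cur = n
  search : SearchInv G adj 0 n 0 σ
  out : σ.out = outList G 0 (σ.reg Reg.target)

/-- The invariant while edges are counted. -/
structure Counting (adj : Fin n → List (Fin n)) (σ : State) : Prop where
  mode : σ.reg Reg.mode = 0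
  lt : σ.reg Reg.vertex < n
  vertex : σ.reg Reg.vertex = 2 * σ.reg Reg.target
  edges : σ.reg Reg.edges = degSum adj (σ.reg Reg.vertex)
  quota : σ.reg Reg.quota = 12

/-- The invariant during the division. -/
structure Dividing (adj : Fin n → List (Fin n)) (σ : State) : Prop where
  mode : σ.reg Reg.mode = 1
  lt : σ.reg Reg.target < n
  pos : 0 < σ.reg Reg.target
  target : 2 * σ.reg Reg.target ≤ n + 1
  quota : ∃ t, σ.reg Reg.quota = 12 + 3 * t ∧ σ.reg Reg.edges + t * n = degSum adj n

/-- The invariant of the main mode. The current search started with target `j₀`; this is not `0`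
for the first source, as some trivial triples have been emitted before. -/
structure Main (G : Digraph (Fin n)) (adj : Fin n → List (Fin n)) (σ : State) : Prop where
  mode : σ.reg Reg.mode = 2
  quota : σ.reg Reg.quota = quota adj
  tick : σ.reg Reg.tick < APSD.quota adj
  src : σ.reg Reg.src ≤ n
  lt : σ.reg Reg.target < n
  two : 2 ≤ n
  tables : (σ.reg Reg.prev = 0 ∧ σ.reg Reg.cur = n) ∨ (σ.reg Reg.prev = n ∧ σ.reg Reg.cur = 0)
  out : σ.out = outList G (σ.reg Reg.src) (σ.reg Reg.target)
  search : σ.reg Reg.src < n → ∃ j₀ ≤ σ.reg Reg.target, 2 * j₀ ≤ n + 1 ∧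
    SearchInv G adj (σ.reg Reg.src) (σ.reg Reg.cur)
      ((σ.reg Reg.target - j₀) * APSD.quota adj + σ.reg Reg.tick) σ
  codes : 0 < σ.reg Reg.src → ∀ t < n,
    IsCode n (σ.mem (σ.reg Reg.prev + t)) (distN G (σ.reg Reg.src - 1) t)

/-- The loop invariant. -/
def Inv (G : Digraph (Fin n)) (adj : Fin n → List (Fin n)) (σ : State) : Prop :=
  Constants n σ ∧ ((Preparing G adj σ ∧ (Counting adj σ ∨ Dividing adj σ)) ∨ Main G adj σ)

/-- The measure that decreases in each iteration without output. In the main mode it bounds the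
number of iterations until the next output, where the target that equals the previous source
is passed without output. -/
def measure (adj : Fin n → List (Fin n)) (σ : State) : ℕ :=
  if σ.reg Reg.mode = 2 then
    (quota adj - σ.reg Reg.tick) +
      if σ.reg Reg.src = σ.reg Reg.target + 1 then quota adj + 1 else 0
  else (quota adj - σ.reg Reg.quota) + (2 * quota adj + 2)

/-- What one iteration of the loop has to establish. -/
def IterPost (G : Digraph (Fin n)) (adj : Fin n → List (Fin n)) (σ σ' : State) : Prop :=
  (σ'.reg Reg.done < σ'.reg Reg.one →
    Inv G adj σ' ∧ (σ.out.length < σ'.out.length ∨ measure adj σ' < measure adj σ)) ∧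
  (¬ σ'.reg Reg.done < σ'.reg Reg.one → σ'.out = outList G n n)

theorem IterPost.proceed {σ σ' : State} (hc : Constants n σ')
    (h : (Preparing G adj σ' ∧ (Counting adj σ' ∨ Dividing adj σ')) ∨ Main G adj σ')
    (hm : σ.out.length < σ'.out.length ∨ measure adj σ' < measure adj σ) :
    IterPost G adj σ σ' :=
  ⟨fun _ => ⟨⟨hc, h⟩, hm⟩, fun h0 => by rw [hc.done, hc.one] at h0; omega⟩

theorem IterPost.halt {σ σ' : State} (h1 : σ'.reg Reg.one = 1) (hd : σ'.reg Reg.done = 1)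
    (h : σ'.out = outList G n n) : IterPost G adj σ σ' :=
  ⟨fun h0 => by rw [hd, h1] at h0; omega, fun _ => h⟩

theorem degSum_succ (v : ℕ) : degSum adj (v + 1) = degSum adj v + inputDeg adj v :=
  Finset.sum_range_succ _ _

theorem wp_countPair (hadj : IsAdjLists G adj) {W : ℕ}
    (hW : 3 * degSum adj n + 4 * n + 20 ≤ W) {σ : State} (hc : Constants n σ)
    (hlt : σ.reg Reg.vertex < n) (hedges : σ.reg Reg.edges = degSum adj (σ.reg Reg.vertex)) :
    countPair.wp W (3 * n) adj (fun σ' =>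
      (σ'.reg Reg.vertex = σ.reg Reg.vertex + 2 ∨
        σ'.reg Reg.vertex = σ.reg Reg.vertex + 1 ∧ σ.reg Reg.vertex + 1 = n) ∧
      σ'.reg Reg.vertex ≤ n ∧
      σ'.reg Reg.edges = degSum adj (σ'.reg Reg.vertex) ∧ σ'.mem = σ.mem ∧ σ'.out = σ.out ∧
      ∀ r, r < 7 ∨ 9 < r → σ'.reg r = σ.reg r) σ := by
  obtain ⟨reg, mem, out⟩ := σ
  obtain ⟨h1, h2, h3, h4, h5, h6⟩ := hc
  have hd0 := degSum_succ (adj := adj) (reg Reg.vertex)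
  have hd1 := degSum_succ (adj := adj) (reg Reg.vertex + 1)
  have hm0 : degSum adj (reg Reg.vertex + 1) ≤ degSum adj n := degSum_mono hlt
  have hm1 : reg Reg.vertex + 1 < n → degSum adj (reg Reg.vertex + 2) ≤ degSum adj n :=
    fun h => degSum_mono h
  have hdeg : inputDeg adj (reg Reg.vertex + 1) ≤ n := inputDeg_le hadj _
  simp only at *
  simp +decide only [countPair, Cmd.block, Cmd.wp, wpInstr, State.set, Function.update_apply,
    if_true, if_false, h2, h4]
  refine ⟨by omega, by omega, by omega, fun hv => ⟨by omega, by omega, by omega, Or.inl trivial,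
    by omega, by omega, trivial, trivial, fun r hr => ?_⟩, fun hv => ⟨Or.inr ⟨trivial, by omega⟩,
    by omega, by omega, trivial, trivial, fun r hr => ?_⟩⟩
  · simp only [Reg.vertex, Reg.edges, Reg.tmp]; grind
  · simp only [Reg.vertex, Reg.edges, Reg.tmp]; grind

theorem wp_countStep (hadj : IsAdjLists G adj) {W : ℕ}
    (hW : 3 * degSum adj n + 4 * n + 20 ≤ W) {σ : State} (hc : Constants n σ)
    (hp : Preparing G adj σ) (h : Counting adj σ) :
    countStep.wp W (3 * n) adj (IterPost G adj σ) σ := by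
  refine Cmd.wp_seq (wp_countPair hadj hW hc h.lt h.edges) ?_
  rintro ⟨reg, mem, out⟩ ⟨hv, hvn, he, hmem, hout, hr⟩
  simp only at hv hvn he hmem hout hr
  have h1 : reg Reg.zero = 0 := (hr _ (by decide)).trans hc.zero
  have h2 : reg Reg.one = 1 := (hr _ (by decide)).trans hc.one
  have h3 : reg Reg.three = 3 := (hr _ (by decide)).trans hc.three
  have h4 : reg Reg.n = n := (hr _ (by decide)).trans hc.order
  have h5 : reg Reg.queue = 2 * n := (hr _ (by decide)).trans hc.queue
  have h6 : reg Reg.done = 0 := (hr _ (by decide)).trans hc.done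
  have h7 : reg Reg.src = 0 := (hr _ (by decide)).trans hp.src
  have h8 : reg Reg.tick = 0 := (hr _ (by decide)).trans hp.tick
  have h9 : reg Reg.prev = 0 := (hr _ (by decide)).trans hp.prev
  have h10 : reg Reg.cur = n := (hr _ (by decide)).trans hp.cur
  have h11 : reg Reg.quota = 12 := (hr _ (by decide)).trans h.quota
  have h12 : reg Reg.mode = 0 := (hr _ (by decide)).trans h.mode
  have ht : reg Reg.target = σ.reg Reg.target := hr _ (by decide)
  have hvt := h.vertex
  have hlt := h.lt
  have hout' : out ++ [(reg Reg.target, reg Reg.target, ((0 : ℕ) : ℕ∞))] =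
      outList G 0 (reg Reg.target + 1) := by
    rw [outList_zero_succ, hout, hp.out, ht]; rfl
  have hlen : σ.out.length <
      (out ++ [(reg Reg.target, reg Reg.target, ((0 : ℕ) : ℕ∞))]).length := by
    simp [hout]
  have hs : ∀ σ' : State, (∀ r, 20 ≤ r → σ'.reg r = reg r) → σ'.mem = mem →
      SearchInv G adj 0 n 0 σ' := fun σ' h1 h2 =>
    hp.search.congr (fun r h => (h1 r h).trans (hr r (by omega))) (h2.trans hmem)
  simp +decide only [Cmd.block, Cmd.wp, wpInstr, State.set, Function.update_apply,
    if_true, if_false, h1, h2, h4]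
  refine ⟨by omega, fun hlt' => IterPost.proceed ?_ (Or.inl ⟨?_, Or.inl ?_⟩) (Or.inl hlen),
    fun hge => ⟨by omega, fun htn => ⟨by omega, IterPost.halt ?_ ?_ ?_⟩, fun htn =>
    IterPost.proceed ?_ (Or.inl ⟨?_, Or.inr ?_⟩) (Or.inl hlen)⟩⟩
  · constructor <;> simp +decide only [Function.update_apply, if_false, h1, h2, h3, h4, h5, h6]
  · refine ⟨?_, ?_, ?_, ?_, hs _ (fun r h => ?_) rfl, ?_⟩
    iterate 4 simp +decide only [Function.update_apply, if_false, h7, h8, h9, h10]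
    · exact Function.update_of_ne (by rintro rfl; revert h; decide) _ _
    · simp +decide only [Function.update_apply, if_true, hout']
  · constructor <;> simp +decide only [Function.update_apply, if_true, if_false, h11, h12, he]
    · exact hlt'
    · omega
  · simp +decide only [Function.update_apply, if_false, h2]
  · simp +decide only [Function.update_apply, if_true]
  · obtain rfl : n = 1 := by omega
    rw [outList_succ_self, outList_succ_zero]
    simpa only [htn] using hout'
  · constructor <;> simp +decide only [Function.update_apply, if_false, h1, h2, h3, h4, h5, h6]
  · refine ⟨?_, ?_, ?_, ?_, hs _ (fun r h => ?_) rfl, ?_⟩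
    iterate 4 simp +decide only [Function.update_apply, if_false, h7, h8, h9, h10]
    · simp only
      rw [Function.update_of_ne (by rintro rfl; revert h; decide),
        Function.update_of_ne (by rintro rfl; revert h; decide)]
    · simp +decide only [Function.update_apply, if_true, if_false, hout']
  · have hvn' : reg Reg.vertex = n := by omega
    refine ⟨?_, ?_, ?_, ?_, 0, ?_, ?_⟩ <;>
      simp +decide only [Function.update_apply, if_true, if_false, he, h11, hvn'] <;> omega

theorem wp_divStep {W : ℕ} (hn : 0 < n)
    (hW : 3 * degSum adj n + 4 * n + 20 ≤ W) {σ : State} (hc : Constants n σ)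
    (hp : Preparing G adj σ) (h : Dividing adj σ) :
    divStep.wp W (3 * n) adj (IterPost G adj σ) σ := by
  obtain ⟨reg, mem, out⟩ := σ
  obtain ⟨h1, h2, h3, h4, h5, h6⟩ := hc
  obtain ⟨h7, h8, h9, h10, h11, h12⟩ := hp
  obtain ⟨h13, h14, h18, h15, t, h16, h17⟩ := h
  have hq := quota_le (adj := adj)
  simp only at *
  simp +decide only [divStep, Cmd.block, Cmd.wp, wpInstr, State.set, Function.update_apply,
    if_false, h3, h4]
  refine ⟨fun hlt => ⟨by omega, IterPost.proceed ?_ (Or.inr ?_) (Or.inr ?_)⟩, fun hge => ?_⟩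
  · constructor <;> simp +decide only [Function.update_apply, if_false, h1, h2, h3, h4, h5, h6]
  · have hquota : 12 + 3 * t = quota adj := by
      rw [quota, ← h17, Nat.add_mul_div_right _ _ hn, Nat.div_eq_of_lt hlt, zero_add]
    constructor <;> try simp +decide only [Function.update_apply, if_true, if_false, h7, h8, h9,
      h10, h16, hquota]
    · unfold quota; omega
    · omega
    · exact h14
    · omega
    · simp
    · exact h12
    · exact fun _ => ⟨reg Reg.target, le_rfl, h15, (h11.congr
        (σ' := ⟨Function.update reg Reg.mode 2, mem, out⟩) (fun r h =>
          Function.update_of_ne (by rintro rfl; revert h; decide) _ _) rfl).cast (by simp)⟩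
    · exact fun h => h.elim
  · simp +decide only [measure, Function.update_apply, if_true, if_false, h7, h8, h13]
    rw [if_neg (by omega)]
    omega
  · have hle : 12 + 3 * (t + 1) ≤ quota adj := by
      have : t + 1 ≤ degSum adj n / n := by
        rw [Nat.le_div_iff_mul_le hn, add_mul]; omega
      unfold quota; omega
    refine ⟨by omega, by omega, by omega, IterPost.proceed ?_ (Or.inl ⟨?_, Or.inr ?_⟩) (Or.inr ?_)⟩
    · constructor <;> simp +decide only [Function.update_apply, if_false, h1, h2, h3, h4, h5, h6]
    · refine ⟨?_, ?_, ?_, ?_, h11.congr (fun r h => ?_) rfl, ?_⟩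
      iterate 4 simp +decide only [Function.update_apply, if_false, h7, h8, h9, h10]
      · simp only
        rw [Function.update_of_ne (by rintro rfl; revert h; decide),
          Function.update_of_ne (by rintro rfl; revert h; decide)]
      · simp +decide only [Function.update_apply, if_false, h12]
    · refine ⟨?_, ?_, ?_, ?_, t + 1, ?_, ?_⟩ <;>
        simp +decide only [Function.update_apply, if_true, if_false, h13, h14, h15, h16, h18]
      · omega
      · rw [add_mul]; omega
    · simp +decide only [measure, Function.update_apply, if_true, if_false, h13]
      omega

/-- The triple for the current target is emitted, unless the target is the previous source. -/
theorem wp_emitStep {W : ℕ} (hW : 4 * n + 20 ≤ W) {σ : State} (hc : Constants n σ)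
    (hsrc : σ.reg Reg.src ≤ n) (hlt : σ.reg Reg.target < n)
    (hprev : σ.reg Reg.prev ≤ n)
    (hcodes : 0 < σ.reg Reg.src → ∀ t < n,
      IsCode n (σ.mem (σ.reg Reg.prev + t)) (distN G (σ.reg Reg.src - 1) t))
    (hout : σ.out = outList G (σ.reg Reg.src) (σ.reg Reg.target)) :
    emitStep.wp W (3 * n) adj (fun σ' =>
      σ'.out = outList G (σ.reg Reg.src) (σ.reg Reg.target + 1) ∧
      (σ.reg Reg.src ≠ σ.reg Reg.target + 1 → σ.out.length < σ'.out.length) ∧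
      σ'.mem = σ.mem ∧ ∀ r, r < 16 ∨ 18 < r → σ'.reg r = σ.reg r) σ := by
  obtain ⟨reg, mem, out⟩ := σ
  obtain ⟨h1, h2, h3, h4, h5, h6⟩ := hc
  simp only at *
  simp +decide only [emitStep, Cmd.block, Cmd.wp, wpInstr, State.set, Function.update_apply,
    if_true, if_false, h1, h2, h4]
  refine ⟨fun h0 => ⟨?_, fun _ => by simp, trivial, fun _ _ => trivial⟩, fun h0 => ?_⟩
  · rw [hout, h0, outList_zero_succ]; rfl
  · obtain ⟨s, hs⟩ : ∃ s, reg Reg.src = s + 1 := ⟨reg Reg.src - 1, by omega⟩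
    have hcode := hcodes (by omega) _ hlt
    rw [hs, Nat.add_sub_cancel] at hcode
    rw [hs] at hout
    simp only [hs, Nat.add_sub_cancel, Reg.outVal, Reg.outAddr, Reg.prevSrc]
    refine ⟨by omega, by omega, fun ht => ⟨?_, fun h => by omega, trivial, fun r hr => by grind⟩,
      fun ht => ?_⟩
    · rw [hout, ht, outList_succ_self]
    · rw [outList_succ_succ ht, hout]
      refine ⟨by omega, by omega, ?_, fun hv => ⟨?_, fun _ => by simp, trivial,
        fun r hr => by grind⟩, fun hv => ⟨?_, fun _ => by simp, trivial, fun r hr => by grind⟩⟩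
      · rcases hcode with h | h <;> omega
      · rw [(hcode.resolve_right (by omega)).2]
      · rw [(hcode.resolve_left (fun h => hv h.1)).2]

/-- The start of the next search, or the halt, after all targets have been dealt with. -/
theorem wp_nextSource {W : ℕ} (hn : 2 ≤ n)
    (hW : 4 * n + 20 ≤ W) {σ : State} (hc : Constants n σ)
    (hmode : σ.reg Reg.mode = 2) (hquota : σ.reg Reg.quota = quota adj)
    (htick : σ.reg Reg.tick = 0) (hsrc : σ.reg Reg.src ≤ n)
    (htables : (σ.reg Reg.prev = 0 ∧ σ.reg Reg.cur = n) ∨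
      (σ.reg Reg.prev = n ∧ σ.reg Reg.cur = 0))
    (hout : σ.out = outList G (σ.reg Reg.src) n)
    (hcodes : σ.reg Reg.src < n → ∀ t < n,
      IsCode n (σ.mem (σ.reg Reg.cur + t)) (distN G (σ.reg Reg.src) t)) :
    nextSource.wp W (3 * n) adj (fun σ' =>
      (σ'.reg Reg.one = 1 ∧ σ'.reg Reg.done = 1 ∧ σ'.out = outList G n n) ∨
      (Constants n σ' ∧ Main G adj σ' ∧ σ'.out = σ.out ∧ σ.reg Reg.src < n)) σ := by
  obtain ⟨reg, mem, out⟩ := σ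
  obtain ⟨h1, h2, h3, h4, h5, h6⟩ := hc
  simp only at *
  simp +decide only [nextSource, Cmd.block, Cmd.wp, wpInstr, State.set, Function.update_apply,
    if_true, if_false, h2, h4, h5]
  refine ⟨by omega, by omega, by omega, by omega, by omega, by omega, by omega, by omega,
    by omega, by omega, by omega, by omega, fun hlt => ⟨by omega, Or.inl ?_⟩,
    fun hge => Or.inr ⟨?_, ?_, trivial, by omega⟩⟩
  · refine ⟨trivial, trivial, ?_⟩
    rw [hout, show reg Reg.src = n by omega]
  · constructor <;> simp +decide only [Function.update_apply, if_false, h1, h2, h3, h4, h5, h6]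
  · constructor <;> try simp +decide only [Function.update_apply, if_true, if_false, hmode,
      hquota, htick]
    · unfold quota; omega
    · omega
    · omega
    · exact hn
    · exact htables.symm.imp And.symm And.symm
    · rw [hout, outList_succ_zero]
    · refine fun _ => ⟨0, le_rfl, by omega, (SearchInv.start (by omega) ?_ ?_ ?_ ?_ ?_ ?_
        ?_).cast (by simp)⟩ <;> simp +decide only [Function.update_apply, if_true, if_false]
    · intro _ t ht
      rw [if_neg (by omega)]
      exact hcodes (by omega) t ht

theorem wp_mainStep (hadj : IsAdjLists G adj) {W : ℕ}
    (hW : 3 * degSum adj n + 4 * n + 20 ≤ W) {σ : State} (hc : Constants n σ)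
    (h : Main G adj σ) :
    mainStep.wp W (3 * n) adj (IterPost G adj σ) σ := by
  have hsearch : (Cmd.ifLt Reg.src Reg.n searchStep .skip).wp W (3 * n) adj (fun σ' =>
      (σ.reg Reg.src < n → ∃ j₀ ≤ σ.reg Reg.target, 2 * j₀ ≤ n + 1 ∧
        SearchInv G adj (σ.reg Reg.src) (σ.reg Reg.cur)
          ((σ.reg Reg.target - j₀) * quota adj + σ.reg Reg.tick + 1) σ') ∧
      σ'.out = σ.out ∧ (∀ r < 20, σ'.reg r = σ.reg r) ∧
      (0 < σ.reg Reg.src → ∀ t < n,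
        IsCode n (σ'.mem (σ.reg Reg.prev + t)) (distN G (σ.reg Reg.src - 1) t))) σ := by
    refine ⟨fun hlt => ?_, fun hge => ?_⟩
    · rw [hc.order] at hlt
      obtain ⟨j₀, h1, h2, h3⟩ := h.search hlt
      refine Cmd.wp_mono ?_ (wp_searchStep hadj (by omega) hc.zero hc.one hc.order hc.queue hlt rfl
        rfl (by have := h.tables; omega) h3)
      rintro σ' ⟨h4, h5, h6, h7⟩
      refine ⟨fun _ => ⟨j₀, h1, h2, h4⟩, h5, h6, fun h8 t ht => ?_⟩
      rw [h7 _ (by have := h.tables; omega) (by have := h.tables; omega)]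
      exact h.codes h8 t ht
    · rw [hc.order] at hge
      exact ⟨fun hlt => (hge hlt).elim, rfl, fun _ _ => rfl, h.codes⟩
  refine Cmd.wp_seq hsearch ?_
  rintro ⟨reg, mem, out⟩ ⟨hs, hout, hr, hcodes⟩
  simp only at hs hout hr hcodes
  have h1 : reg Reg.zero = 0 := (hr _ (by decide)).trans hc.zero
  have h2 : reg Reg.one = 1 := (hr _ (by decide)).trans hc.one
  have h3 : reg Reg.three = 3 := (hr _ (by decide)).trans hc.three
  have h4 : reg Reg.n = n := (hr _ (by decide)).trans hc.order
  have h5 : reg Reg.queue = 2 * n := (hr _ (by decide)).trans hc.queue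
  have h6 : reg Reg.done = 0 := (hr _ (by decide)).trans hc.done
  have h7 : reg Reg.mode = 2 := (hr _ (by decide)).trans h.mode
  have h8 : reg Reg.quota = quota adj := (hr _ (by decide)).trans h.quota
  have htick : reg Reg.tick = σ.reg Reg.tick := hr _ (by decide)
  have hsrc : reg Reg.src = σ.reg Reg.src := hr _ (by decide)
  have htarget : reg Reg.target = σ.reg Reg.target := hr _ (by decide)
  have hprev : reg Reg.prev = σ.reg Reg.prev := hr _ (by decide)
  have hcur : reg Reg.cur = σ.reg Reg.cur := hr _ (by decide)
  have hmeasure : measure adj σ = quota adj - reg Reg.tick +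
      if reg Reg.src = reg Reg.target + 1 then quota adj + 1 else 0 := by
    simp only [measure, h.mode, if_true, htick, hsrc, htarget]
  obtain ⟨-, -, g1, g2, g3, g4, g5, g6, -, -⟩ := h
  have hq := quota_le (adj := adj)
  have hqpos : 0 < quota adj := by unfold quota; omega
  rw [← htick] at hs g1
  rw [← hsrc] at hs g2 g6 hcodes
  rw [← htarget] at hs g3 g6
  rw [← hprev] at g5 hcodes
  rw [← hcur] at g5 hs
  rw [← hout] at g6
  clear hr htick hsrc htarget hprev hcur hc
  simp +decide only [Cmd.block, Cmd.wp, wpInstr, State.set, Function.update_apply,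
    if_true, if_false, h2, h8]
  refine ⟨by omega, fun hlt => ?_, fun hge => ⟨by omega, ?_⟩⟩
  · refine IterPost.proceed ?_ (Or.inr ?_) (Or.inr ?_)
    · constructor <;> simp +decide only [Function.update_apply, if_false, h1, h2, h3, h4, h5, h6]
    · constructor <;> try simp +decide only [Function.update_apply, if_true, if_false, h7, h8]
      · exact hlt
      · exact g2
      · exact g3
      · exact g4
      · exact g5
      · exact g6
      · intro h9
        obtain ⟨j₀, h10, h11, h12⟩ := hs h9
        exact ⟨j₀, h10, h11, h12.congr (fun r h =>
          Function.update_of_ne (by rintro rfl; revert h; decide) _ _) rfl⟩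
      · exact hcodes
    · rw [hmeasure]
      simp +decide only [measure, Function.update_apply, if_true, if_false, h7]
      omega
  · refine Cmd.wp_mono ?_ (wp_emitStep (G := G) (by omega) ?_ ?_ ?_ ?_ ?_ ?_)
    · rintro ⟨reg', mem', out'⟩ ⟨e1, e2, e3, e4⟩
      simp +decide only [Function.update_apply, if_false] at e1 e2 e3
      subst e3
      clear hsearch
      have f1 : reg' Reg.zero = 0 :=
        (e4 _ (by decide)).trans (by simp +decide only [Function.update_apply, if_false, h1])
      have f2 : reg' Reg.one = 1 :=
        (e4 _ (by decide)).trans (by simp +decide only [Function.update_apply, if_false, h2])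
      have f3 : reg' Reg.three = 3 :=
        (e4 _ (by decide)).trans (by simp +decide only [Function.update_apply, if_false, h3])
      have f4 : reg' Reg.n = n :=
        (e4 _ (by decide)).trans (by simp +decide only [Function.update_apply, if_false, h4])
      have f5 : reg' Reg.queue = 2 * n :=
        (e4 _ (by decide)).trans (by simp +decide only [Function.update_apply, if_false, h5])
      have f6 : reg' Reg.done = 0 :=
        (e4 _ (by decide)).trans (by simp +decide only [Function.update_apply, if_false, h6])
      have f7 : reg' Reg.mode = 2 :=
        (e4 _ (by decide)).trans (by simp +decide only [Function.update_apply, if_false, h7])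
      have f8 : reg' Reg.quota = quota adj :=
        (e4 _ (by decide)).trans (by simp +decide only [Function.update_apply, if_false, h8])
      have f9 : reg' Reg.src = reg Reg.src :=
        (e4 _ (by decide)).trans (by simp +decide only [Function.update_apply, if_false])
      have f10 : reg' Reg.target = reg Reg.target :=
        (e4 _ (by decide)).trans (by simp +decide only [Function.update_apply, if_false])
      have f11 : reg' Reg.prev = reg Reg.prev :=
        (e4 _ (by decide)).trans (by simp +decide only [Function.update_apply, if_false])
      have f12 : reg' Reg.cur = reg Reg.cur :=
        (e4 _ (by decide)).trans (by simp +decide only [Function.update_apply, if_false])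
      have f13 : reg' Reg.tick = 0 :=
        (e4 _ (by decide)).trans (by simp +decide only [Function.update_apply, if_true])
      have f14 : ∀ r, 20 ≤ r → reg' r = reg r := fun r h => (e4 r (by omega)).trans (by
        simp only
        rw [Function.update_of_ne (by rintro rfl; revert h; decide),
          Function.update_of_ne (by rintro rfl; revert h; decide)])
      clear e4
      simp only [f2, f4, f10]
      refine ⟨by omega, fun hlt => ?_, fun hend => ?_⟩
      · refine IterPost.proceed ?_ (Or.inr ?_) ?_
        · constructor <;>
            simp +decide only [Function.update_apply, if_false, f1, f2, f3, f4, f5, f6]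
        · constructor <;> try simp +decide only [Function.update_apply, if_true, if_false, f7, f8,
            f9, f11, f12, f13]
          · exact hqpos
          · exact g2
          · exact hlt
          · exact g4
          · exact g5
          · exact e1
          · intro h9
            obtain ⟨j₀, h10, h11, h12⟩ := hs h9
            refine ⟨j₀, by omega, h11, (h12.congr (σ' := ⟨Function.update reg' Reg.target
              (reg Reg.target + 1), mem', out'⟩) (fun r h => ?_) rfl).cast ?_⟩
            · exact (Function.update_of_ne (by rintro rfl; revert h; decide) _ _).trans (f14 r h)
            · rw [Nat.sub_add_comm h10, add_mul]; omega
          · exact hcodes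
        · by_cases hskip : reg Reg.src = reg Reg.target + 1
          · right
            rw [hmeasure]
            simp +decide only [measure, Function.update_apply, if_true, if_false, f7, f9, f13,
              hskip]
            rw [if_neg (by omega)]
            omega
          · left
            rw [← hout]
            exact e2 hskip
      · have htn : reg Reg.target + 1 = n := by omega
        refine Cmd.wp_mono ?_ (wp_nextSource (G := G) g4 (by omega) ?_ ?_ ?_ ?_ ?_ ?_ ?_ ?_)
        · rintro σ' (⟨k1, k2, k3⟩ | ⟨k1, k2, k3, k4⟩)
          · exact IterPost.halt k1 k2 k3
          · refine IterPost.proceed k1 (Or.inr k2) (Or.inl ?_)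
            simp +decide only [Function.update_apply, if_false, f9] at k3 k4
            rw [k3, ← hout]
            exact e2 (by omega)
        · constructor <;>
            simp +decide only [Function.update_apply, if_false, f1, f2, f3, f4, f5, f6]
        all_goals simp +decide only [Function.update_apply, if_false, f7, f8, f9, f11, f12, f13]
        · exact g2
        · exact g5
        · rw [e1, htn]
        · intro h9 t ht
          obtain ⟨j₀, h10, h11, h12⟩ := hs h9
          -- all targets but the first `j₀` have been used for the search: it is complete
          refine h12.isCode hadj ?_ ht
          have := search_lt_mul_quota (adj := adj) (by omega : 0 < n) (k := reg Reg.target - j₀ + 1)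
            (by omega)
          rw [add_mul] at this
          omega
    · constructor <;> simp +decide only [Function.update_apply, if_false, h1, h2, h3, h4, h5, h6]
    all_goals simp +decide only [Function.update_apply, if_false]
    · exact g2
    · exact g3
    · omega
    · exact hcodes
    · exact g6

theorem wp_loopBody (hadj : IsAdjLists G adj) (hn : 0 < n) {W : ℕ}
    (hW : 3 * degSum adj n + 4 * n + 20 ≤ W) {σ : State} (h : Inv G adj σ) :
    loopBody.wp W (3 * n) adj (IterPost G adj σ) σ := by
  obtain ⟨hc, ⟨hp, h | h⟩ | h⟩ := h
  · exact ⟨fun _ => wp_countStep hadj hW hc hp h, fun h0 => (h0 (h.mode.trans hc.zero.symm)).elim⟩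
  · refine ⟨fun h0 => ?_, fun _ => ⟨fun _ => wp_divStep hn hW hc hp h, fun h1 => ?_⟩⟩
    · rw [h.mode, hc.zero] at h0; omega
    · rw [h.mode, hc.one] at h1; omega
  · refine ⟨fun h0 => ?_, fun _ => ⟨fun h1 => ?_, fun _ => wp_mainStep hadj hW hc h⟩⟩
    · rw [h.mode, hc.zero] at h0; omega
    · rw [h.mode, hc.one] at h1; omega

theorem wp_prelude (hn : 0 < n) {W : ℕ} (hW : 4 * n + 20 ≤ W) {σ : State}
    (hout : σ.out = []) :
    prelude.wp W (3 * n) adj (Inv G adj) σ := by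
  simp +decide only [prelude, Cmd.block, Cmd.wp, wpInstr, State.set, Function.update_apply,
    if_true, if_false]
  refine ⟨by omega, by omega, by omega, by omega, by omega, by omega, by omega, by omega, by omega,
    by omega, by omega, by omega, by omega, by omega, by omega, by omega, by omega, by omega,
    by omega, by omega, by omega, by omega, ?_, Or.inl ⟨?_, Or.inl ?_⟩⟩
  · constructor <;> simp +decide only [Function.update_apply, if_true, if_false, two_mul]
  · refine ⟨?_, ?_, ?_, ?_, SearchInv.start hn ?_ ?_ ?_ ?_ ?_ ?_ ?_, ?_⟩ <;>
      simp +decide only [Function.update_apply, if_true, if_false, two_mul]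
    exact hout
  · constructor <;> simp +decide only [Function.update_apply, if_true, if_false]
    exact hn
    rfl

theorem measure_le {σ : State} : measure adj σ ≤ 3 * quota adj + 2 := by
  unfold measure
  split_ifs <;> omega

theorem length_out_le {σ : State} (h : Inv G adj σ) : σ.out.length ≤ (n + 1) * n := by
  obtain ⟨hc, ⟨hp, h⟩ | h⟩ := h
  · rw [hp.out]
    refine (length_outList_le 0 ?_).trans (Nat.mul_le_mul_right _ (by omega))
    rcases h with h | h
    · have := h.lt; have := h.vertex; omega
    · exact h.lt.le
  · rw [h.out]
    exact (length_outList_le _ h.lt.le).trans (Nat.mul_le_mul_right _ (by have := h.src; omega))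

end

/-! ### Word size and space -/

/-- The words are large enough for all numbers that occur. -/
theorem bound_le_two_pow {n m w : ℕ} (hm : m ≤ n * n) (hw : 10 * (Nat.log 2 n + 1) ≤ w) :
    3 * m + 4 * n + 20 ≤ 2 ^ w := by
  have h1 : n + 1 ≤ 2 ^ (Nat.log 2 n + 1) := Nat.lt_pow_succ_log_self (by norm_num) n
  have h2 : 2 ≤ 2 ^ (Nat.log 2 n + 1) := by
    rw [pow_succ]; have := Nat.one_le_two_pow (n := Nat.log 2 n); omega
  -- two of the ten factors give `(n + 1) ^ 2`, and the other eight a constant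
  have h3 : (2 ^ (Nat.log 2 n + 1)) ^ 10 ≤ 2 ^ w := by
    rw [← pow_mul, mul_comm]; exact Nat.pow_le_pow_right (by norm_num) hw
  have h4 : 2 ^ 8 * (n + 1) ^ 2 ≤ (2 ^ (Nat.log 2 n + 1)) ^ 10 := by
    rw [show 10 = 8 + 2 by norm_num, pow_add]
    gcongr
  nlinarith

/-- The fourth step of the program puts the first source into the queue. This access bounds the
space from below, even if `n = 1`, when no search takes place. -/
theorem accesses_queue {n w : ℕ} (adj : Fin n → List (Fin n)) (hw : 4 * n + 20 ≤ 2 ^ w)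
    {c₀ : Config} (hpc : c₀.pc = 0) :
    Accesses enumProgram (run enumProgram w adj c₀ 3) (2 * n) := by
  have h0 : enumProgram[0]? = some (.order Reg.n) := rfl
  have h1 : enumProgram[1]? = some (.add Reg.queue Reg.n Reg.n) := rfl
  have h2 : enumProgram[2]? = some (.const Reg.zero 0) := rfl
  have h3 : enumProgram[3]? = some (.store Reg.queue Reg.zero) := rfl
  right
  refine ⟨Reg.queue, Reg.zero, ?_, ?_⟩ <;>
    simp [run, step, hpc, h0, h1, h2, h3, exec, Config.setReg]
  rw [Nat.mod_eq_of_lt] <;> omega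

end APSD

theorem mainTheorem2 :
    ∃ (P : APSD.Program) (K : ℕ) (C c₁ c₂ : ℝ), 0 < c₁ ∧
      ∀ (n : ℕ), 0 < n →
      ∀ (G : Digraph (Fin n)) (adj : Fin n → List (Fin n)), APSD.IsAdjLists G adj →
      ∀ (w : ℕ), K * (Nat.log 2 n + 1) ≤ w →
      ∀ (c₀ : APSD.Config), APSD.IsInitial w c₀ →
        (∃ T : ℕ, APSD.Halted P (APSD.run P w adj c₀ T) ∧
          APSD.IsEnumeration G (APSD.run P w adj c₀ T).out) ∧
        (∃ D : ℕ, (D : ℝ) ≤ C * (APSD.avgDegree G + 1) ∧ APSD.HasDelay P w adj c₀ D) ∧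
        (∃ S : ℕ, APSD.space P w adj c₀ = (S : ℕ∞) ∧
          c₁ * (n : ℝ) ≤ (S : ℝ) ∧ (S : ℝ) ≤ c₂ * (n : ℝ)) := by
  -- one loop iteration takes at most `loopBody.size + 1` steps, and the delay is at most
  -- `3 * quota + 4` iterations, where `quota ≤ 12 + 3 * avgDegree`
  refine ⟨APSD.enumProgram, 10,
    (APSD.prelude.size : ℝ) + 40 * (APSD.loopBody.size + 1), 1, 3, one_pos, ?_⟩
  intro n hn G adj hadj w hw c₀ hc₀
  have hW := APSD.bound_le_two_pow (APSD.degSum_le hadj n) hw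
  have hstart : c₀ = (APSD.State.mk c₀.reg c₀.mem c₀.out).toConfig 0 :=
    APSD.Config.ext hc₀.1 rfl rfl rfl
  obtain ⟨⟨T, σ, h1, h2, h3⟩, h4, h5⟩ := APSD.loopProgram_spec
    (σ₀ := APSD.State.mk c₀.reg c₀.mem c₀.out)
    (APSD.wp_prelude (G := G) hn (by omega) hc₀.2.1) (fun σ => APSD.wp_loopBody hadj hn hW)
    (fun σ _ => APSD.measure_le) (fun σ => APSD.length_out_le)
  rw [← hstart] at h1 h3 h4 h5
  refine ⟨⟨T, h1, ?_⟩, ⟨_, ?_, h4⟩, ?_⟩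
  · exact h3 ▸ h2 ▸ APSD.isEnumeration_outList
  · have hdiv : ((APSD.degSum adj n / n : ℕ) : ℝ) ≤ APSD.avgDegree G := by
      rw [APSD.avgDegree, ← APSD.degSum_eq hadj]
      exact Nat.cast_div_le
    have h0 : (0 : ℝ) ≤ ((APSD.degSum adj n / n : ℕ) : ℝ) := Nat.cast_nonneg _
    have hs : (0 : ℝ) ≤ (APSD.prelude.size : ℝ) := Nat.cast_nonneg _
    have hb : (0 : ℝ) ≤ (APSD.loopBody.size : ℝ) := Nat.cast_nonneg _
    simp only [APSD.quota]
    push_cast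
    nlinarith [mul_nonneg hs (h0.trans hdiv), mul_nonneg hb (h0.trans hdiv),
      mul_le_mul_of_nonneg_left hdiv hb]
  · have hle : APSD.space APSD.enumProgram w adj c₀ ≤ ((3 * n : ℕ) : ℕ∞) :=
      iSup₂_le fun x ⟨t, ht⟩ => by exact_mod_cast h5 t x ht
    have hge : ((2 * n + 1 : ℕ) : ℕ∞) ≤ APSD.space APSD.enumProgram w adj c₀ :=
      le_iSup₂_of_le (2 * n) ⟨3, APSD.accesses_queue adj (by omega) hc₀.1⟩ le_rfl
    obtain ⟨S, hS⟩ := ENat.ne_top_iff_exists.1 (ne_top_of_le_ne_top (ENat.natCast_ne_top _) hle)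
    rw [← hS] at hle hge
    have hle' : S ≤ 3 * n := by exact_mod_cast hle
    have hge' : 2 * n + 1 ≤ S := by exact_mod_cast hge
    refine ⟨S, hS.symm, ?_, by exact_mod_cast hle'⟩
    have : n ≤ S := by omega
    rw [one_mul]
    exact_mod_cast this
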